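/- Fix $n\ge 1$ and $1<p<\infty$. For $x\in\mathbb R^n$, $t\in\mathbb R$, $L>0$ let $Q(x,L)=\{y\in\mathbb R^n: |y_i-x_i|\le L,\ i=1,\dots,n\}$. The parabolic rectangle $R=R(x,t,L)=Q(x,L)\times(t-L^p,t+L^p)\subset\mathbb R^{n+1}$ has, for $0\le\gamma<1$, the upper and lower parts $$R^+(\gamma)=Q(x,L)\times(t+\gamma L^p,\,t+L^p),\qquad R^-(\gamma)=Q(x,L)\times(t-L^p,\,t-\gamma L^p).$$ Write $\langle f\rangle_A=\frac1{|A|}\int_A f$ for integral averages with respect to Lebesgue measure. A weight is a locally integrable nonnegative function $w$ on $\mathbb R^{n+1}$. For $1<q<\infty$, $w\in A_q^+(\gamma)$ means that $$\sup_{R}\langle w\rangle_{R^-(\gamma)}\,\bigl\langle w^{\frac1{1-q}}\bigr\rangle_{R^+(\gamma)}^{\,q-1}<\infty,$$ where the supremum is over all parabolic rectangles $R$ (with $0^{1/(1-q)}=\infty$ and $0\cdot\infty=0$), and $w\in A_1^+(\gamma)$ means that there is a constant $C>0$ with $\langle w\rangle_{R^-(\gamma)}\le C\operatorname{ess\,inf}_{R^+(\gamma)}w$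 for every parabolic rectangle $R$. **Corollary.** Let $1\le q<\infty$, $0<\gamma<1$ and let $w\in A_q^+(\gamma)$ be a weight. Let $0\le\alpha<1$ and $\tau>0$. Then there exist $\varepsilon>0$ and $c>0$ such that $$\Bigl(\bigl\langle w^{1+\varepsilon}\bigr\rangle_{R^-(\alpha)}\Bigr)^{\frac1{1+\varepsilon}}\le c\,\langle w\rangle_{S^+(\alpha)}$$ for every parabolic rectangle $R=R(x,t,L)\subset\mathbb R^{n+1}$, where $S^+(\alpha)=R^-(\alpha)+(0,\tau(1-\alpha)L^p)$ is the translate of $R^-(\alpha)$ forward in time by $\tau(1-\alpha)L^p$. In particular the left-hand side is finite. -/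

import Mathlib

open MeasureTheory Set
open scoped ENNReal

noncomputable section

/-- Space-time `ℝⁿ⁺¹ = ℝⁿ × ℝ`, with points `(x, t)`; its `volume` is Lebesgue measure. -/
abbrev SpaceTime (n : ℕ) : Type := (Fin n → ℝ) × ℝ

/-- The cube `Q(x, L) = {y : |y i - x i| ≤ L for all i}`. -/
def spaceCube {n : ℕ} (x : Fin n → ℝ) (L : ℝ) : Set (Fin n → ℝ) :=
  {y | ∀ i, |y i - x i| ≤ L}

/-- The upper part `R⁺(γ) = Q(x, L) × (t + γ L ^ p, t + L ^ p)` of the parabolic rectangle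
`R(x, t, L) = Q(x, L) × (t - L ^ p, t + L ^ p)`. -/
def upperPart {n : ℕ} (p γ : ℝ) (x : Fin n → ℝ) (t L : ℝ) : Set (SpaceTime n) :=
  spaceCube x L ×ˢ Ioo (t + γ * L ^ p) (t + L ^ p)

/-- The lower part `R⁻(γ) = Q(x, L) × (t - L ^ p, t - γ L ^ p)` of the parabolic rectangle
`R(x, t, L)`. -/
def lowerPart {n : ℕ} (p γ : ℝ) (x : Fin n → ℝ) (t L : ℝ) : Set (SpaceTime n) :=
  spaceCube x L ×ˢ Ioo (t - L ^ p) (t - γ * L ^ p)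

/-- The translate `A + (0, s)` of a set `A` by `s` in the time direction. -/
def timeTranslate {n : ℕ} (A : Set (SpaceTime n)) (s : ℝ) : Set (SpaceTime n) :=
  (fun z => z + (0, s)) '' A

/-- A weight is a locally integrable nonnegative function. -/
def IsWeight {n : ℕ} (w : SpaceTime n → ℝ) : Prop :=
  LocallyIntegrable w volume ∧ ∀ z, 0 ≤ w z

/-- The constant `[w]` of the class `A_q⁺(γ)` for `1 < q`: the supremum over all parabolic
rectangles of `(⨍_{R⁻(γ)} w) (⨍_{R⁺(γ)} w ^ (1 / (1 - q)) ∂volume) ^ (q - 1)`, computed in `[0, ∞]`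
with `0 ^ (1 / (1 - q)) = ∞` and `0 * ∞ = 0`. -/
def muckenhouptConst {n : ℕ} (p q γ : ℝ) (w : SpaceTime n → ℝ) : ℝ≥0∞ :=
  ⨆ (x : Fin n → ℝ) (t : ℝ) (L : ℝ) (_ : 0 < L),
    (⨍⁻ z in lowerPart p γ x t L, ENNReal.ofReal (w z) ∂volume) *
      (⨍⁻ z in upperPart p γ x t L, ENNReal.ofReal (w z) ^ (1 / (1 - q)) ∂volume) ^ (q - 1)

/-- The condition that defines the class `A_1⁺(γ)`: there is a constant `C > 0` such that
`⨍_{R⁻(γ)} w ≤ C essinf_{R⁺(γ)} w` for every parabolic rectangle. -/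
def MuckenhouptOneCondition {n : ℕ} (p γ : ℝ) (w : SpaceTime n → ℝ) : Prop :=
  ∃ C : ℝ, 0 < C ∧ ∀ (x : Fin n → ℝ) (t L : ℝ), 0 < L →
    (⨍⁻ z in lowerPart p γ x t L, ENNReal.ofReal (w z) ∂volume) ≤
      ENNReal.ofReal C *
        essInf (fun z => ENNReal.ofReal (w z)) (volume.restrict (upperPart p γ x t L))

/-- The weight `w` belongs to the parabolic Muckenhoupt class `A_q⁺(γ)`, for `1 ≤ q < ∞`. -/
def MemParabolicAq {n : ℕ} (p q γ : ℝ) (w : SpaceTime n → ℝ) : Prop :=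
  IsWeight w ∧
    ((1 < q ∧ muckenhouptConst p q γ w < ∞) ∨ (q = 1 ∧ MuckenhouptOneCondition p γ w))

end

/-! By Chebyshev's inequality the Muckenhoupt condition says that a weight is rarely small ahead of
a region where its average is large: on the forward translate of a cylinder, `W` falls below `b`
times the earlier average only on a fraction `η`, and `η` may be any positive number at the cost of
`b`. Besides local integrability, only this `ForwardDensity` is used.

Write `ν` for the measure with density `W`. A stopping-time argument, with volumes collected on
forward translates of the selected cylinders, bounds `ν {W ≥ K c}` by a multiple of `c * volume {W ≥
b c}`, the latter set on a larger neighbourhood (`withDensity_le_of_stopping`). Hole filling turns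
this into a contraction between superlevel sets (`superlevel_recursion`); iteration gives geometric
decay, and summing layers bounds the integral of `W ^ (1 + ε)` over a set by the mass of a
neighbourhood of it (`local_reverse_holder`).

That neighbourhood also reaches beyond the set in space and time. A chain of many small forward
steps compares its mass with that of the translate; as the lag of a step scales like the `p`-th
power of its radius, every `τ > 0` is attainable (`forward_comparison`). -/

/-- The parabolic cylinder with centre `z`, spatial radius `r` and half-duration `κ r ^ p`. -/
def cyl {n : ℕ} (p κ : ℝ) (z : SpaceTime n) (r : ℝ) : Set (SpaceTime n) :=
  spaceCube z.1 r ×ˢ Ioo (z.2 - κ * r ^ p) (z.2 + κ * r ^ p)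

/-- The Lebesgue measure of a parabolic cylinder of radius `r`. -/
noncomputable def cylVol (n : ℕ) (p κ r : ℝ) : ℝ≥0∞ :=
  ENNReal.ofReal (2 ^ n * (2 * κ) * r ^ (n + p))

theorem spaceCube_eq_closedBall {n : ℕ} (x : Fin n → ℝ) {r : ℝ} (hr : 0 ≤ r) :
    spaceCube x r = Metric.closedBall x r := by
  ext y
  simp [spaceCube, Metric.mem_closedBall, dist_pi_le_iff hr, Real.dist_eq]

theorem measurableSet_spaceCube {n : ℕ} (x : Fin n → ℝ) {r : ℝ} (hr : 0 ≤ r) :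
    MeasurableSet (spaceCube x r) := by
  rw [spaceCube_eq_closedBall x hr]
  exact Metric.isClosed_closedBall.measurableSet

theorem volume_spaceCube {n : ℕ} (x : Fin n → ℝ) {r : ℝ} (hr : 0 ≤ r) :
    volume (spaceCube x r) = ENNReal.ofReal ((2 * r) ^ n) := by
  rw [spaceCube_eq_closedBall x hr, Real.volume_pi_closedBall x hr, Fintype.card_fin]

/-! ### Quasi-metric geometry of parabolic cylinders and Vitali covering. -/

section Cylinders

variable {n : ℕ} {p κ : ℝ}

theorem mem_cyl {z y : SpaceTime n} {r : ℝ} :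
    y ∈ cyl p κ z r ↔ (∀ i, |y.1 i - z.1 i| ≤ r) ∧ |y.2 - z.2| < κ * r ^ p := by
  simp only [cyl, mem_prod, spaceCube, mem_ofPred_eq, mem_Ioo, abs_lt]
  constructor <;> rintro ⟨h1, h2, h3⟩ <;> exact ⟨h1, by linarith, by linarith⟩

theorem mem_cyl_symm {z y : SpaceTime n} {r : ℝ} (h : y ∈ cyl p κ z r) : z ∈ cyl p κ y r := by
  rw [mem_cyl] at h ⊢
  simpa only [abs_sub_comm] using h

theorem mem_cyl_self (hκ : 0 < κ) (z : SpaceTime n) {r : ℝ} (hr : 0 < r) : z ∈ cyl p κ z r := by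
  rw [mem_cyl]
  simp only [sub_self, abs_zero]
  exact ⟨fun _ => hr.le, by positivity⟩

theorem cyl_mono (hp : 1 ≤ p) (hκ : 0 < κ) (z : SpaceTime n) {r s : ℝ} (hr : 0 ≤ r) (h : r ≤ s) :
    cyl p κ z r ⊆ cyl p κ z s := by
  intro y hy
  rw [mem_cyl] at hy ⊢
  refine ⟨fun i => (hy.1 i).trans h, hy.2.trans_le ?_⟩
  gcongr

/-- The triangle inequality for cylinders: in time it rests on `r ^ p + s ^ p ≤ (r + s) ^ p` for `p
≥ 1`. -/
theorem mem_cyl_add (hp : 1 ≤ p) (hκ : 0 < κ) {x y z : SpaceTime n} {r s : ℝ} (hr : 0 ≤ r)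
    (hs : 0 ≤ s) (h1 : y ∈ cyl p κ x r) (h2 : z ∈ cyl p κ y s) : z ∈ cyl p κ x (r + s) := by
  rw [mem_cyl] at *
  constructor
  · intro i
    have := abs_add_le (z.1 i - y.1 i) (y.1 i - x.1 i)
    rw [sub_add_sub_cancel] at this
    linarith [h1.1 i, h2.1 i]
  · have := abs_add_le (z.2 - y.2) (y.2 - x.2)
    rw [sub_add_sub_cancel] at this
    have h3 := mul_le_mul_of_nonneg_left (Real.add_rpow_le_rpow_add hr hs hp) hκ.le
    linarith [h1.2, h2.2]

theorem cyl_subset_cyl_add (hp : 1 ≤ p) (hκ : 0 < κ) {x y : SpaceTime n} {r s : ℝ} (hr : 0 ≤ r)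
    (hs : 0 ≤ s) (h : y ∈ cyl p κ x r) : cyl p κ y s ⊆ cyl p κ x (r + s) :=
  fun _ hz => mem_cyl_add hp hκ hr hs h hz

theorem measurableSet_cyl (z : SpaceTime n) {r : ℝ} (hr : 0 ≤ r) :
    MeasurableSet (cyl p κ z r) :=
  (measurableSet_spaceCube _ hr).prod measurableSet_Ioo

theorem volume_cyl (z : SpaceTime n) {r : ℝ} (hr : 0 < r) :
    volume (cyl p κ z r) = cylVol n p κ r := by
  rw [cyl, Measure.volume_eq_prod, Measure.prod_prod, volume_spaceCube _ hr.le, Real.volume_Ioo,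
    ← ENNReal.ofReal_mul (by positivity), cylVol, Real.rpow_add hr, Real.rpow_natCast]
  congr 1
  ring

theorem cylVol_mul {h r : ℝ} (hh : 0 ≤ h) (hr : 0 ≤ r) :
    cylVol n p κ (h * r) = ENNReal.ofReal (h ^ (n + p)) * cylVol n p κ r := by
  rw [cylVol, cylVol, ← ENNReal.ofReal_mul (by positivity), Real.mul_rpow hh hr]
  congr 1
  ring

theorem cylVol_ne_top (r : ℝ) : cylVol n p κ r ≠ ∞ := ENNReal.ofReal_ne_top

theorem cylVol_ne_zero (hκ : 0 < κ) {r : ℝ} (hr : 0 < r) : cylVol n p κ r ≠ 0 := by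
  rw [cylVol, ne_eq, ENNReal.ofReal_eq_zero, not_le]
  positivity

theorem cylVol_mono (hp : 1 ≤ p) (hκ : 0 < κ) {r s : ℝ} (hr : 0 ≤ r) (h : r ≤ s) :
    cylVol n p κ r ≤ cylVol n p κ s := by
  rw [cylVol, cylVol]
  gcongr

theorem mem_interior_cyl (hκ : 0 < κ) (z : SpaceTime n) {r : ℝ} (hr : 0 < r) :
    z ∈ interior (cyl p κ z r) := by
  rw [cyl, interior_prod_eq, spaceCube_eq_closedBall _ hr.le, isOpen_Ioo.interior_eq]
  have : 0 < κ * r ^ p := by positivity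
  exact ⟨Metric.ball_subset_interior_closedBall (Metric.mem_ball_self hr),
    by linarith, by linarith⟩

theorem exists_cyl_subset_of_isOpen (hp : 1 ≤ p) (hκ : 0 < κ) {U : Set (SpaceTime n)}
    (hU : IsOpen U) {z : SpaceTime n} (hz : z ∈ U) : ∃ r, 0 < r ∧ cyl p κ z r ⊆ U := by
  obtain ⟨ε, hε, hb⟩ := Metric.isOpen_iff.1 hU z hz
  set r := min 1 (min (ε / 2) (ε / (2 * κ))) with hrdef
  have hr : 0 < r := by positivity
  have hr1 : r ≤ 1 := min_le_left _ _
  have hr2 : r ≤ ε / 2 := (min_le_right _ _).trans (min_le_left _ _)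
  have hr3 : r ≤ ε / (2 * κ) := (min_le_right _ _).trans (min_le_right _ _)
  refine ⟨r, hr, fun y hy => hb ?_⟩
  rw [mem_cyl] at hy
  have h4 : r ^ p ≤ r := by
    simpa using Real.rpow_le_rpow_of_exponent_ge hr hr1 hp
  have h5 : κ * r ^ p ≤ ε / 2 := by
    calc κ * r ^ p ≤ κ * (ε / (2 * κ)) := by gcongr; exact h4.trans hr3
      _ = ε / 2 := by field_simp
  rw [Metric.mem_ball, Prod.dist_eq, max_lt_iff]
  refine ⟨(dist_pi_lt_iff hε).2 fun i => ?_, ?_⟩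
  · rw [Real.dist_eq]
    linarith [hy.1 i]
  · rw [Real.dist_eq]
    linarith [hy.2]

/-- Vitali covering for parabolic cylinders. -/
theorem exists_disjoint_cyl_covering (hp : 1 ≤ p) (hκ : 0 < κ) {h : ℝ} (hh : 0 < h)
    (T : Set (SpaceTime n × ℝ)) (R : ℝ) (hT : ∀ i ∈ T, 0 < i.2 ∧ i.2 ≤ R) :
    ∃ u ⊆ T, u.Countable ∧ u.PairwiseDisjoint (fun i => cyl p κ i.1 (h * i.2)) ∧
      ∀ i ∈ T, ∃ j ∈ u, i.1 ∈ cyl p κ j.1 (3 * h * j.2) := by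
  obtain ⟨u, huT, hdisj, hcov⟩ := Vitali.exists_disjoint_subfamily_covering_enlargement
    (fun i : SpaceTime n × ℝ => cyl p κ i.1 (h * i.2)) T (fun i => i.2) 2 one_lt_two
    (fun i hi => (hT i hi).1.le) R (fun i hi => (hT i hi).2)
    (fun i hi => ⟨i.1, mem_cyl_self hκ _ (mul_pos hh (hT i hi).1)⟩)
  refine ⟨u, huT, ?_, hdisj, fun i hi => ?_⟩
  · exact hdisj.countable_of_nonempty_interior fun i hi =>
      ⟨i.1, mem_interior_cyl hκ _ (mul_pos hh (hT i (huT hi)).1)⟩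
  -- Only the centre of a discarded cylinder has to be covered, so `h * i.2 + h * j.2 ≤ 3 * h * j.2`
  -- suffices and the factor is 3 instead of 5.
  · obtain ⟨j, hj, ⟨y, hyi, hyj⟩, hij⟩ := hcov i hi
    have hi0 := (hT i hi).1
    have hj0 := (hT j (huT hj)).1
    have := mem_cyl_add hp hκ (by positivity) (by positivity) hyj (mem_cyl_symm hyi)
    exact ⟨j, hj, cyl_mono hp hκ _ (by positivity) (by nlinarith) this⟩

/-- The union of the cylinders of radius `σ` centred in `E`. -/
def thick (p κ : ℝ) (E : Set (SpaceTime n)) (σ : ℝ) : Set (SpaceTime n) :=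
  {y | ∃ z ∈ E, y ∈ cyl p κ z σ}

theorem subset_thick (hκ : 0 < κ) (E : Set (SpaceTime n)) {σ : ℝ} (hσ : 0 < σ) :
    E ⊆ thick p κ E σ :=
  fun z hz => ⟨z, hz, mem_cyl_self hκ z hσ⟩

theorem thick_mono (hp : 1 ≤ p) (hκ : 0 < κ) (E : Set (SpaceTime n)) {r s : ℝ} (hr : 0 ≤ r)
    (h : r ≤ s) : thick p κ E r ⊆ thick p κ E s :=
  fun _ ⟨z, hz, hy⟩ => ⟨z, hz, cyl_mono hp hκ z hr h hy⟩

theorem cyl_subset_thick (hp : 1 ≤ p) (hκ : 0 < κ) {E : Set (SpaceTime n)} {r s σ : ℝ}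
    (hr : 0 ≤ r) (hs : 0 ≤ s) (h : r + s ≤ σ) {y : SpaceTime n} (hy : y ∈ thick p κ E r) :
    cyl p κ y s ⊆ thick p κ E σ := by
  obtain ⟨z, hz, hyz⟩ := hy
  exact fun w hw => ⟨z, hz, cyl_mono hp hκ z (by positivity) h (mem_cyl_add hp hκ hr hs hyz hw)⟩

end Cylinders

/-! ### Weak differentiation, forward density and the stopping-time estimate. -/

section Density

variable {n : ℕ} {p κ : ℝ} {W : SpaceTime n → ℝ≥0∞}

/-- Allowing an arbitrary `F` spares all later measurability questions. A `ν`-measurable hull of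
`F`, cut down to `{c ≤ W}`, still contains `F`. -/
theorem mul_volume_le_withDensity (hW : Measurable W) {c : ℝ≥0∞} {F : Set (SpaceTime n)}
    (hF : ∀ z ∈ F, c ≤ W z) : c * volume F ≤ volume.withDensity W F := by
  set ν := volume.withDensity W
  have hm : MeasurableSet {z | c ≤ W z} := measurableSet_le measurable_const hW
  have ht : MeasurableSet (toMeasurable ν F ∩ {z | c ≤ W z}) :=
    (measurableSet_toMeasurable ν F).inter hm
  calc c * volume F ≤ c * volume (toMeasurable ν F ∩ {z | c ≤ W z}) := by
        gcongr
        exact fun z hz => ⟨subset_toMeasurable ν F hz, hF z hz⟩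
    _ = ∫⁻ _ in toMeasurable ν F ∩ {z | c ≤ W z}, c := by rw [setLIntegral_const]
    _ ≤ ∫⁻ z in toMeasurable ν F ∩ {z | c ≤ W z}, W z :=
        setLIntegral_mono hW fun z hz => hz.2
    _ = ν (toMeasurable ν F ∩ {z | c ≤ W z}) := (withDensity_apply W ht).symm
    _ ≤ ν (toMeasurable ν F) := measure_mono inter_subset_left
    _ = ν F := measure_toMeasurable F

/-- A weak form of Lebesgue differentiation along parabolic cylinders. -/
theorem volume_eq_zero_of_small_averages (hp : 1 ≤ p) (hκ : 0 < κ) (hW : Measurable W)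
    {c K : ℝ≥0∞} (hc : c ≠ 0) (hc' : c ≠ ∞) (hK : 2 * ENNReal.ofReal (3 ^ (n + p)) ≤ K)
    {r₀ : ℝ} (hr₀ : 0 < r₀) {G : Set (SpaceTime n)} (hG : ∀ z ∈ G, K * c ≤ W z)
    (hav : ∀ z ∈ G, ∀ r, 0 < r → r < r₀ →
      volume.withDensity W (cyl p κ z r) ≤ c * cylVol n p κ r) : volume G = 0 := by
  have key : ∀ R : ℕ, volume (G ∩ Metric.ball 0 R) = 0 := by
    intro R
    set A := G ∩ Metric.ball (0 : SpaceTime n) R with hA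
    have hAtop : volume A ≠ ∞ :=
      ((measure_mono inter_subset_right).trans_lt measure_ball_lt_top).ne
    have main : ∀ ε : ℝ≥0∞, ε ≠ 0 → volume A ≤ ε := by
      intro ε hε
      obtain ⟨U, hAU, hUo, hUv⟩ := A.exists_isOpen_lt_add hAtop hε
      -- The cores stay inside `U`, while their triples are still short enough for `hav`. Hence `ν
      -- A` is controlled by `volume U`, which is close to `volume A`, and `K` is too large for this
      -- unless `A` is null.
      set T : Set (SpaceTime n × ℝ) :=
        {i | i.1 ∈ A ∧ 0 < i.2 ∧ 3 * i.2 < r₀ ∧ cyl p κ i.1 i.2 ⊆ U} with hT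
      obtain ⟨u, huT, huc, hdisj, hcov⟩ := exists_disjoint_cyl_covering hp hκ one_pos T r₀
        (fun i hi => ⟨hi.2.1, by linarith [hi.2.1, hi.2.2.1]⟩)
      have hsub : A ⊆ ⋃ j ∈ u, cyl p κ j.1 (3 * j.2) := by
        intro z hz
        obtain ⟨r, hr, hrU⟩ := exists_cyl_subset_of_isOpen hp hκ hUo (hAU hz)
        have hm : 0 < min r (r₀ / 4) := by positivity
        obtain ⟨j, hj, hzj⟩ := hcov (z, min r (r₀ / 4))
          ⟨hz, hm, by
            have := min_le_right r (r₀ / 4)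
            simp only
            linarith, (cyl_mono hp hκ z hm.le (min_le_left _ _)).trans hrU⟩
        rw [mul_one] at hzj
        exact mem_biUnion hj hzj
      have hν : volume.withDensity W A ≤ c * (ENNReal.ofReal (3 ^ (n + p)) * volume U) := by
        calc volume.withDensity W A
            ≤ ∑' j : u, volume.withDensity W (cyl p κ j.1.1 (3 * j.1.2)) :=
              (measure_mono hsub).trans (measure_biUnion_le _ huc _)
          _ ≤ ∑' j : u, c * (ENNReal.ofReal (3 ^ (n + p)) * volume (cyl p κ j.1.1 (1 * j.1.2))) := by
              refine ENNReal.tsum_le_tsum fun j => ?_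
              obtain ⟨h1, h2, h3, -⟩ := huT j.2
              rw [one_mul, volume_cyl _ h2, ← cylVol_mul (by norm_num) h2.le]
              exact hav _ h1.1 _ (by linarith) h3
          _ = c * (ENNReal.ofReal (3 ^ (n + p)) *
                volume (⋃ j ∈ u, cyl p κ j.1 (1 * j.2))) := by
              rw [ENNReal.tsum_mul_left, ENNReal.tsum_mul_left, measure_biUnion huc hdisj]
              intro j hj
              exact measurableSet_cyl _ (by linarith [(huT hj).2.1])
          _ ≤ _ := by
              gcongr
              refine iUnion₂_subset fun j hj => ?_
              rw [one_mul]
              exact (huT hj).2.2.2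
      have h1 : c * (K * volume A) ≤ c * (ENNReal.ofReal (3 ^ (n + p)) * volume U) := by
        rw [← mul_assoc, mul_comm c K]
        exact (mul_volume_le_withDensity hW fun z hz => hG z hz.1).trans hν
      rw [ENNReal.mul_le_mul_iff_right hc hc'] at h1
      have h2 : ENNReal.ofReal (3 ^ (n + p)) * (2 * volume A) ≤
          ENNReal.ofReal (3 ^ (n + p)) * (volume A + ε) := by
        calc _ = 2 * ENNReal.ofReal (3 ^ (n + p)) * volume A := by ring
          _ ≤ K * volume A := by gcongr
          _ ≤ _ := h1
          _ ≤ _ := by gcongr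
      rw [ENNReal.mul_le_mul_iff_right (by simp; positivity) ENNReal.ofReal_ne_top, two_mul] at h2
      exact (ENNReal.add_le_add_iff_left hAtop).1 h2
    by_contra h0
    have := main (volume A / 2) (by simpa using h0)
    exact absurd this (not_le.2 (ENNReal.half_lt_self h0 hAtop))
  have : G = ⋃ R : ℕ, G ∩ Metric.ball 0 R := by
    rw [← inter_iUnion, Metric.iUnion_ball_nat, inter_univ]
  rw [this]
  exact measure_iUnion_null key

/-- On the cylinder obtained from `cyl z r` by moving it forward in time by `a r ^ p`, the set where
`W` is less than `β` times the average of `W` over `cyl z r` has relative measure at most `η`. -/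
def ForwardDensity (p κ a : ℝ) (W : SpaceTime n → ℝ≥0∞) (η β : ℝ≥0∞) : Prop :=
  ∀ (z : SpaceTime n) (r : ℝ), 0 < r →
    volume (cyl p κ (z + (0, a * r ^ p)) r ∩
      {y | W y < β * (volume.withDensity W (cyl p κ z r) / cylVol n p κ r)}) ≤ η * cylVol n p κ r

/-- It is enough that `c` lies below the average over `cyl z r`: the points of `D` with `W y < β *
c` are then exceptional. -/
theorem ForwardDensity.le_volume {a : ℝ} {η β : ℝ≥0∞} (H : ForwardDensity p κ a W η β)
    (hW : Measurable W) {z : SpaceTime n} {r : ℝ} (hr : 0 < r) {D : Set (SpaceTime n)}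
    (hD : D ⊆ cyl p κ (z + (0, a * r ^ p)) r) {c : ℝ≥0∞}
    (hc : c * cylVol n p κ r ≤ volume.withDensity W (cyl p κ z r)) (hκ : 0 < κ) :
    volume D ≤ volume (D ∩ {y | β * c ≤ W y}) + η * cylVol n p κ r := by
  have hm : MeasurableSet {y | β * c ≤ W y} := measurableSet_le measurable_const hW
  rw [← measure_inter_add_sdiff D hm]
  gcongr
  refine (measure_mono ?_).trans (H z r hr)
  rintro y ⟨hy, hy'⟩
  refine ⟨hD hy, ?_⟩
  simp only [mem_ofPred_eq, not_le] at hy' ⊢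
  refine hy'.trans_le ?_
  gcongr
  rwa [ENNReal.le_div_iff_mul_le (.inl (cylVol_ne_zero hκ hr)) (.inl (cylVol_ne_top r))]

/-- The superlevel set estimate at one level. -/
theorem withDensity_le_of_stopping (hp : 1 ≤ p) (hκ : 0 < κ) (hW : Measurable W) {a h : ℝ}
    (ha : 0 ≤ a) (hh : h = 1 + a / κ) {β : ℝ≥0∞} (H : ForwardDensity p κ a W 2⁻¹ β)
    {c K : ℝ≥0∞} (hc : c ≠ 0) (hc' : c ≠ ∞) (hK : 2 * ENNReal.ofReal (3 ^ (n + p)) ≤ K)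
    {r₀ : ℝ} (hr₀ : 0 < r₀) {F D : Set (SpaceTime n)} (hF : ∀ z ∈ F, K * c ≤ W z)
    (hav : ∀ z ∈ F, ∀ r, r₀ ≤ r → r ≤ 3 * h * r₀ →
      volume.withDensity W (cyl p κ z r) ≤ c * cylVol n p κ r)
    (hD : ∀ z ∈ F, cyl p κ z (h * r₀) ⊆ D) :
    volume.withDensity W F ≤
      2 * ENNReal.ofReal ((3 * h) ^ (n + p)) * c * volume (D ∩ {y | β * c ≤ W y}) := by
  have hh1 : 1 ≤ h := by rw [hh]; linarith [div_nonneg ha hκ.le]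
  set ν := volume.withDensity W with hν
  -- The points without a stopping radius; they form a null set, since `W ≥ K * c` there although
  -- all small averages are at most `c`.
  set N := {z ∈ F | ∀ r, 0 < r → r < r₀ → ν (cyl p κ z r) ≤ c * cylVol n p κ r} with hN
  have hN0 : ν N = 0 := by
    refine withDensity_absolutelyContinuous volume W ?_
    exact volume_eq_zero_of_small_averages hp hκ hW hc hc' hK hr₀ (fun z hz => hF z hz.1)
      fun z hz => hz.2
  -- Stopping radii that are maximal up to a factor 2, as the supremum need not be attained. Since
  -- `3 * h ≥ 2`, the average over the enlarged cylinder is again at most `c`.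
  set T : Set (SpaceTime n × ℝ) := {i | i.1 ∈ F ∧ (0 < i.2 ∧ i.2 < r₀ ∧
    c * cylVol n p κ i.2 < ν (cyl p κ i.1 i.2)) ∧
      ∀ r, 2 * i.2 ≤ r → r < r₀ → ν (cyl p κ i.1 r) ≤ c * cylVol n p κ r} with hT
  obtain ⟨u, huT, huc, hdisj, hcov⟩ := exists_disjoint_cyl_covering hp hκ
    (show 0 < h by linarith) T r₀ (fun i hi => ⟨hi.2.1.1, hi.2.1.2.1.le⟩)
  have hsub : F ⊆ N ∪ ⋃ j ∈ u, cyl p κ j.1 (3 * h * j.2) := by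
    intro z hz
    by_cases hzN : z ∈ N
    · exact .inl hzN
    right
    have hzN' : ∃ r, 0 < r ∧ r < r₀ ∧ c * cylVol n p κ r < ν (cyl p κ z r) := by
      by_contra hcon
      push Not at hcon
      exact hzN ⟨hz, hcon⟩
    set S := {r | 0 < r ∧ r < r₀ ∧ c * cylVol n p κ r < ν (cyl p κ z r)} with hS
    have hSne : S.Nonempty := hzN'
    have hSb : BddAbove S := ⟨r₀, fun r hr => hr.2.1.le⟩
    obtain ⟨s, hs⟩ := hzN'
    have hpos : 0 < sSup S := hs.1.trans_le (le_csSup hSb hs)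
    obtain ⟨r, hrS, hr⟩ := exists_lt_of_lt_csSup hSne (half_lt_self hpos)
    obtain ⟨j, hj, hzj⟩ := hcov (z, r) ⟨hz, hrS, fun r' h1 h2 => by
      by_contra hcon
      push Not at hcon
      have := le_csSup hSb (show r' ∈ S from ⟨by linarith [hrS.1], h2, hcon⟩)
      simp only at h1
      linarith⟩
    exact mem_biUnion hj hzj
  -- Here `h = 1 + a / κ` enters: `κ * h = κ + a` and `h ≤ h ^ p`. Disjointness of the enlarged
  -- cylinders thus passes to the forward translates.
  have hshift : ∀ j ∈ u, cyl p κ (j.1 + (0, a * j.2 ^ p)) j.2 ⊆ cyl p κ j.1 (h * j.2) := by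
    intro j hj y hy
    have hj0 := (huT hj).2.1.1
    rw [mem_cyl] at hy ⊢
    simp only [Prod.fst_add, Prod.snd_add, add_zero] at hy
    refine ⟨fun i => (hy.1 i).trans (le_mul_of_one_le_left hj0.le hh1), ?_⟩
    have h1 : |y.2 - j.1.2| ≤ |y.2 - (j.1.2 + a * j.2 ^ p)| + a * j.2 ^ p := by
      have := abs_add_le (y.2 - (j.1.2 + a * j.2 ^ p)) (a * j.2 ^ p)
      rwa [abs_of_nonneg (show 0 ≤ a * j.2 ^ p by positivity),
        show y.2 - (j.1.2 + a * j.2 ^ p) + a * j.2 ^ p = y.2 - j.1.2 by ring] at this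
    have h2 : h ≤ h ^ p := by
      simpa using Real.rpow_le_rpow_of_exponent_le hh1 hp
    have h3 : κ * h = κ + a := by rw [hh]; field_simp
    rw [Real.mul_rpow (by linarith) hj0.le]
    have h4 : (κ + a) * j.2 ^ p ≤ κ * (h ^ p * j.2 ^ p) := by
      rw [← h3, mul_assoc]
      gcongr
    linarith [hy.2]
  have hone : ∀ j ∈ u, cylVol n p κ j.2 ≤
      2 * volume (cyl p κ (j.1 + (0, a * j.2 ^ p)) j.2 ∩ {y | β * c ≤ W y}) := by
    intro j hj
    obtain ⟨-, ⟨hj0, -, hjc⟩, -⟩ := huT hj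
    have h1 := H.le_volume hW hj0 subset_rfl hjc.le hκ
    rw [volume_cyl _ hj0] at h1
    set X := volume (cyl p κ (j.1 + (0, a * j.2 ^ p)) j.2 ∩ {y | β * c ≤ W y})
    set v := cylVol n p κ j.2
    have h2 : v ≠ ∞ := cylVol_ne_top _
    have h3 : 2⁻¹ * v + 2⁻¹ * v = v := by rw [← add_mul, ENNReal.inv_two_add_inv_two, one_mul]
    have h4 : 2⁻¹ * v ≤ X := by
      refine (ENNReal.add_le_add_iff_right (a := 2⁻¹ * v) ?_).1 (h3.trans_le h1)
      exact ENNReal.mul_ne_top (by simp) h2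
    rw [two_mul, ← h3]
    gcongr
  have hm : MeasurableSet {y | β * c ≤ W y} := measurableSet_le measurable_const hW
  calc ν F ≤ ν N + ν (⋃ j ∈ u, cyl p κ j.1 (3 * h * j.2)) :=
        (measure_mono hsub).trans (measure_union_le _ _)
    _ ≤ ∑' j : u, ν (cyl p κ j.1.1 (3 * h * j.1.2)) := by
        rw [hN0, zero_add]
        exact measure_biUnion_le _ huc _
    _ ≤ ∑' j : u, (2 * ENNReal.ofReal ((3 * h) ^ (n + p)) * c) *
          volume (cyl p κ (j.1.1 + (0, a * j.1.2 ^ p)) j.1.2 ∩ {y | β * c ≤ W y}) := by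
        refine ENNReal.tsum_le_tsum fun j => ?_
        obtain ⟨h1, ⟨h2, h3, -⟩, h4⟩ := huT j.2
        have h5 : ν (cyl p κ j.1.1 (3 * h * j.1.2)) ≤ c * cylVol n p κ (3 * h * j.1.2) := by
          rcases lt_or_ge (3 * h * j.1.2) r₀ with h6 | h6
          · exact h4 _ (by nlinarith) h6
          · exact hav _ h1 _ h6 (by gcongr)
        rw [cylVol_mul (by positivity) h2.le] at h5
        refine h5.trans ((mul_le_mul_right (mul_le_mul_right (hone _ j.2) _) _).trans_eq ?_)
        ring
    _ = (2 * ENNReal.ofReal ((3 * h) ^ (n + p)) * c) *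
          volume (⋃ j ∈ u, cyl p κ (j.1 + (0, a * j.2 ^ p)) j.2 ∩ {y | β * c ≤ W y}) := by
        rw [ENNReal.tsum_mul_left, measure_biUnion huc]
        · exact hdisj.mono_on fun j hj => inter_subset_left.trans (hshift j hj)
        · exact fun j hj => (measurableSet_cyl _ (huT hj).2.1.1.le).inter hm
    _ ≤ _ := by
        gcongr
        refine iUnion₂_subset fun j hj => inter_subset_inter_left _ ((hshift j hj).trans ?_)
        obtain ⟨h1, ⟨h2, h3, -⟩, h4⟩ := huT hj
        refine (cyl_mono hp hκ _ (by positivity) ?_).trans (hD _ h1)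
        gcongr

end Density

/-! ### Decay of superlevel sets and the reverse Hölder inequality on neighbourhoods. -/

section ReverseHolder

variable {n : ℕ} {p κ : ℝ} {W : SpaceTime n → ℝ≥0∞}

/-- Hole filling: the stopping estimate bounds the mass above the high level by the volume of `{W ≥
l}`, hence by the masses between and above the two levels. Adding a multiple of the mass above puts
the same coefficient on both parts. -/
theorem superlevel_recursion (hp : 1 ≤ p) (hκ : 0 < κ) (hW : Measurable W) {a h : ℝ}
    (ha : 0 ≤ a) (hh : h = 1 + a / κ) {b : ℝ} (hb : 0 < b)
    (H : ForwardDensity p κ a W 2⁻¹ (ENNReal.ofReal b)) {K A : ℝ}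
    (hK : K = 4 * (3 * h) ^ (n + p)) (hA1 : 1 ≤ A) (hAb : K ≤ b * A)
    {c : ℝ≥0∞} (hc : c ≠ 0) (hc' : c ≠ ∞) {r₀ : ℝ} (hr₀ : 0 < r₀)
    {E D : Set (SpaceTime n)} (hED : E ⊆ D)
    (hav : ∀ z ∈ E, ∀ r, r₀ ≤ r → r ≤ 3 * h * r₀ →
      volume.withDensity W (cyl p κ z r) ≤ ENNReal.ofReal A * c * cylVol n p κ r)
    (hD : ∀ z ∈ E, cyl p κ z (h * r₀) ⊆ D) :
    volume.withDensity W (E ∩ {y | ENNReal.ofReal A * (ENNReal.ofReal K * c) ≤ W y}) ≤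
      ENNReal.ofReal ((A + 1) / (A + 2)) *
        volume.withDensity W (D ∩ {y | ENNReal.ofReal K * c ≤ W y}) := by
  have hh1 : 1 ≤ h := by rw [hh]; linarith [div_nonneg ha hκ.le]
  have hA0 : 0 < A := by linarith
  have hK0 : 0 ≤ K := by rw [hK]; positivity
  set ν := volume.withDensity W
  set l := ENNReal.ofReal K * c with hl
  set l' := ENNReal.ofReal A * l with hl'
  have hll' : l ≤ l' := le_mul_of_one_le_left (by simp) (by simpa using hA1)
  have hm : MeasurableSet {y | l' ≤ W y} := measurableSet_le measurable_const hW
  set G := D ∩ {y | l ≤ W y} with hG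
  set y := G ∩ {y | l' ≤ W y} with hy
  set x := G \ {y | l' ≤ W y} with hx
  set f := ν (E ∩ {y | l' ≤ W y}) with hf
  have hxy : ν y + ν x = ν G := measure_inter_add_sdiff G hm
  have hfy : f ≤ ν y := measure_mono fun z hz => ⟨⟨hED hz.1, hll'.trans hz.2⟩, hz.2⟩
  have hlevel : f ≤ 2⁻¹ * (l' * volume G) := by
    -- The stopping level is `A * c`: then `K * (A * c) = l'`, while `b * A ≥ K` puts the good
    -- points in `{W ≥ l}`. The choice `K = 4 * (3 * h) ^ (n + p)` makes the constant exactly `l' /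
    -- 2`.
    have h1 := withDensity_le_of_stopping hp hκ hW ha hh H (c := ENNReal.ofReal A * c)
      (K := ENNReal.ofReal K) (F := E ∩ {y | l' ≤ W y}) (D := D)
      (mul_ne_zero (by simpa using hA0) hc) (ENNReal.mul_ne_top ENNReal.ofReal_ne_top hc')
      (by
        rw [← ENNReal.ofReal_ofNat, ← ENNReal.ofReal_mul (by norm_num), hK]
        apply ENNReal.ofReal_le_ofReal
        have : (3:ℝ) ^ (n + p) ≤ (3 * h) ^ (n + p) := by
          gcongr
          linarith
        have : (0:ℝ) ≤ 3 ^ (n + p) := by positivity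
        linarith)
      hr₀ (fun z hz => by
        refine le_of_eq_of_le ?_ hz.2
        rw [hl', hl]
        ring) (fun z hz => hav z hz.1) (fun z hz => hD z hz.1)
    refine h1.trans ?_
    calc _ ≤ 2 * ENNReal.ofReal ((3 * h) ^ (n + p)) * (ENNReal.ofReal A * c) * volume G := by
          gcongr
          refine inter_subset_inter_right _ fun z hz => ?_
          rw [mem_ofPred_eq] at hz ⊢
          refine le_trans ?_ hz
          rw [hl, ← mul_assoc, ← ENNReal.ofReal_mul hb.le]
          gcongr
      _ = _ := by
          have : ENNReal.ofReal K = 2 * 2 * ENNReal.ofReal ((3 * h) ^ (n + p)) := by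
            rw [hK, ENNReal.ofReal_mul (by norm_num)]
            norm_num
          rw [hl', hl, this]
          have h2 : (2⁻¹ : ℝ≥0∞) * 2 = 1 := ENNReal.inv_mul_cancel (by simp) (by simp)
          rw [← one_mul (2 * _ * _ * _), ← h2]
          ring
  have hvol : l' * volume G ≤ ENNReal.ofReal A * ν x + ν y := by
    have h1 : volume G = volume y + volume x := (measure_inter_add_sdiff G hm).symm
    rw [h1, mul_add, add_comm]
    refine add_le_add ?_ (mul_volume_le_withDensity hW fun z hz => hz.2)
    rw [hl', mul_assoc]
    gcongr
    exact mul_volume_le_withDensity hW fun z hz => hz.1.2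
  have h2 : (ENNReal.ofReal A + 2) * f ≤ (ENNReal.ofReal A + 1) * ν G := by
    calc (ENNReal.ofReal A + 2) * f = ENNReal.ofReal A * f + 2 * f := add_mul _ _ _
      _ ≤ ENNReal.ofReal A * ν y + 2 * (2⁻¹ * (ENNReal.ofReal A * ν x + ν y)) := by
          gcongr
          exact hlevel.trans (by gcongr)
      _ = ENNReal.ofReal A * ν y + (ENNReal.ofReal A * ν x + ν y) := by
          rw [← mul_assoc, ENNReal.mul_inv_cancel (by simp) (by simp), one_mul]
      _ ≤ ENNReal.ofReal A * ν y + (ENNReal.ofReal A * ν x + ν y) + ν x := le_self_add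
      _ = _ := by rw [← hxy]; ring
  have h3 : ENNReal.ofReal ((A + 1) / (A + 2)) = (ENNReal.ofReal A + 1) / (ENNReal.ofReal A + 2) := by
    rw [ENNReal.ofReal_div_of_pos (by linarith), ENNReal.ofReal_add hA0.le (by norm_num),
      ENNReal.ofReal_add hA0.le (by norm_num)]
    norm_num
  rw [h3, ENNReal.div_eq_inv_mul, mul_assoc, ← ENNReal.div_eq_inv_mul,
    ENNReal.le_div_iff_mul_le (.inl (by simp)) (.inl (by finiteness)), mul_comm]
  exact h2

/-- The recursion is iterated along the shrinking neighbourhoods of radii `B ^ k * σ`, with stopping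
radii bounded by multiples of the gaps between them. -/
theorem superlevel_decay (hp : 1 ≤ p) (hκ : 0 < κ) (hW : Measurable W) {a b : ℝ}
    (ha : 0 ≤ a) (hb : 0 < b) (H : ForwardDensity p κ a W 2⁻¹ (ENNReal.ofReal b)) :
    ∃ A K : ℝ, 1 < A ∧ 0 < K ∧ ∀ (E : Set (SpaceTime n)) (σ : ℝ), 0 < σ →
      volume.withDensity W (thick p κ E σ) ≠ 0 → volume.withDensity W (thick p κ E σ) ≠ ∞ →
      ∀ k : ℕ, volume.withDensity W (E ∩ {y | ENNReal.ofReal A ^ k * (ENNReal.ofReal K *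
        (volume.withDensity W (thick p κ E σ) / cylVol n p κ σ)) ≤ W y}) ≤
        ENNReal.ofReal ((A + 1) / (A + 2)) ^ k * volume.withDensity W (thick p κ E σ) := by
  obtain ⟨h, hh⟩ : ∃ h, h = 1 + a / κ := ⟨_, rfl⟩
  have hh1 : 1 ≤ h := by rw [hh]; linarith [div_nonneg ha hκ.le]
  have hm : 0 < n + p := by positivity
  obtain ⟨K, hK⟩ : ∃ K, K = 4 * (3 * h) ^ (n + p) := ⟨_, rfl⟩
  have hK0 : 0 < K := by rw [hK]; positivity
  set A := max 2 (K / b) with hA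
  have hA2 : 2 ≤ A := le_max_left _ _
  have hA0 : 0 < A := by linarith
  have hAb : K ≤ b * A := by
    have := (div_le_iff₀' hb).1 (le_max_right 2 (K / b))
    exact this
  -- With `B ^ (n + p) = A⁻¹`, shrinking a radius by `B` multiplies `ν₀ / cylVol` by `A`, which is
  -- the ratio of levels in one recursion step.
  set B := A ^ (-(1 / (n + p))) with hB
  have hB0 : 0 < B := by positivity
  have hB1 : B < 1 := Real.rpow_lt_one_of_one_lt_of_neg (by linarith) (by
    rw [neg_lt_zero]; positivity)
  have hBm : B ^ (n + p) = A⁻¹ := by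
    rw [hB, ← Real.rpow_mul hA0.le, neg_mul, one_div, inv_mul_cancel₀ hm.ne', Real.rpow_neg_one]
  -- Chosen so that `3 * h` times the new stopping radius is exactly the gap `(B ^ k - B ^ (k + 1))
  -- * σ`; see `hrad`.
  set q := (1 - B) / (3 * h * B) with hq
  have hq0 : 0 < q := div_pos (by linarith) (by positivity)
  refine ⟨A, K * (q ^ (n + p))⁻¹, by linarith, by positivity, fun E σ hσ hν0 hν1 => ?_⟩
  set ν := volume.withDensity W
  set ν₀ := ν (thick p κ E σ)
  have hc0 : ∀ k : ℕ, 0 < q * B ^ k * σ := fun k => by positivity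
  have hvol : ∀ k : ℕ, ν₀ / cylVol n p κ (q * B ^ k * σ) = ENNReal.ofReal A ^ k *
      (ENNReal.ofReal (q ^ (n + p))⁻¹ * (ν₀ / cylVol n p κ σ)) := by
    intro k
    rw [cylVol_mul (by positivity) hσ.le, ENNReal.div_eq_inv_mul,
      ENNReal.mul_inv (.inr (cylVol_ne_top _)) (.inl ENNReal.ofReal_ne_top),
      ← ENNReal.ofReal_inv_of_pos (by positivity), ENNReal.div_eq_inv_mul,
      ← ENNReal.ofReal_pow hA0.le, ← mul_assoc, ← mul_assoc, ← ENNReal.ofReal_mul (by positivity)]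
    congr 3
    rw [Real.mul_rpow hq0.le (by positivity), mul_inv, ← Real.rpow_natCast B k,
      ← Real.rpow_mul hB0.le, mul_comm (k : ℝ), Real.rpow_mul hB0.le, hBm, Real.inv_rpow hA0.le,
      inv_inv, Real.rpow_natCast, mul_comm]
  have hKq : ENNReal.ofReal (K * (q ^ (n + p))⁻¹) =
      ENNReal.ofReal K * ENNReal.ofReal (q ^ (n + p))⁻¹ := ENNReal.ofReal_mul hK0.le
  have main : ∀ k : ℕ, ν (thick p κ E (B ^ k * σ) ∩ {y | ENNReal.ofReal K *
      (ν₀ / cylVol n p κ (q * B ^ k * σ)) ≤ W y}) ≤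
        ENNReal.ofReal ((A + 1) / (A + 2)) ^ k * ν₀ := by
    intro k
    induction k with
    | zero =>
      simp only [pow_zero, one_mul]
      exact measure_mono inter_subset_left
    | succ k ih =>
      have hBk : B ^ (k + 1) ≤ B ^ k := pow_le_pow_of_le_one hB0.le hB1.le (Nat.le_succ k)
      have hBk1 : B ^ k ≤ 1 := pow_le_one₀ hB0.le hB1.le
      have hrad : 3 * h * (q * B ^ (k + 1) * σ) = (B ^ k - B ^ (k + 1)) * σ := by
        rw [hq, pow_succ]
        field_simp
      have hsucc : ν₀ / cylVol n p κ (q * B ^ (k + 1) * σ) =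
          ENNReal.ofReal A * (ν₀ / cylVol n p κ (q * B ^ k * σ)) := by
        rw [hvol, hvol, pow_succ]
        ring
      have hstep := superlevel_recursion hp hκ hW ha hh hb H hK (by linarith : 1 ≤ A) hAb
        (c := ν₀ / cylVol n p κ (q * B ^ k * σ))
        (ENNReal.div_ne_zero.2 ⟨hν0, cylVol_ne_top _⟩)
        (ENNReal.div_ne_top hν1 (cylVol_ne_zero hκ (hc0 k))) (hc0 (k + 1))
        (E := thick p κ E (B ^ (k + 1) * σ)) (D := thick p κ E (B ^ k * σ))
        (thick_mono hp hκ E (by positivity) (by gcongr))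
        (fun z hz r h1 h2 => by
          rw [← hsucc]
          have hsub : cyl p κ z r ⊆ thick p κ E σ :=
            cyl_subset_thick hp hκ (by positivity) ((hc0 (k + 1)).le.trans h1)
              (by rw [hrad] at h2; nlinarith) hz
          calc ν (cyl p κ z r) ≤ ν₀ := measure_mono hsub
            _ = ν₀ / cylVol n p κ (q * B ^ (k + 1) * σ) * cylVol n p κ (q * B ^ (k + 1) * σ) :=
                (ENNReal.div_mul_cancel (cylVol_ne_zero hκ (hc0 _)) (cylVol_ne_top _)).symm
            _ ≤ _ := by
                gcongr
                exact cylVol_mono hp hκ (hc0 _).le h1)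
        (fun z hz => cyl_subset_thick hp hκ (by positivity) (by positivity) (by
          have : h * (q * B ^ (k + 1) * σ) ≤ 3 * h * (q * B ^ (k + 1) * σ) := by
            gcongr
            linarith
          rw [hrad] at this
          linarith) hz)
      rw [hsucc, pow_succ' (ENNReal.ofReal _), mul_assoc (ENNReal.ofReal _), mul_left_comm (ENNReal.ofReal K)]
      exact hstep.trans (mul_le_mul_right ih _)
  intro k
  refine le_trans (measure_mono ?_) (main k)
  rintro z ⟨hz, hz'⟩
  refine ⟨subset_thick hκ E (by positivity) hz, ?_⟩
  rw [mem_ofPred_eq] at hz' ⊢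
  refine le_of_eq_of_le ?_ hz'
  rw [hvol, hKq]
  ring

/-- Summation of a geometric layer decomposition. -/
theorem rpow_le_add_tsum_layers {ε : ℝ} (hε : 0 < ε) {A l w : ℝ≥0∞} (hA : 1 ≤ A) (hl : l ≠ 0) :
    w ^ ε ≤ l ^ ε + ∑' k : ℕ, (A ^ (k + 1) * l) ^ ε * (if A ^ k * l ≤ w then 1 else 0) := by
  classical
  -- If `w` lies above every level, as when `w = ∞`, all terms are at least `l ^ ε` and the series
  -- diverges. Otherwise the first level above `w` singles out one term that suffices.
  by_cases hall : ∀ k : ℕ, A ^ k * l ≤ w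
  · have : ∑' k : ℕ, (A ^ (k + 1) * l) ^ ε * (if A ^ k * l ≤ w then 1 else 0) = ∞ := by
      rw [eq_top_iff, ← ENNReal.tsum_const_eq_top_of_ne_zero (α := ℕ) (c := l ^ ε)]
      · refine ENNReal.tsum_le_tsum fun k => ?_
        rw [if_pos (hall k), mul_one]
        gcongr
        exact le_mul_of_one_le_left (by simp) (one_le_pow₀ hA)
      · simp [hl, hε.le, hε]
    rw [this]
    simp
  · push Not at hall
    have hw := Nat.find_spec hall
    rcases hk : Nat.find hall with _ | k
    · rw [hk, pow_zero, one_mul] at hw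
      exact le_add_right (by gcongr)
    · rw [hk] at hw
      have hmin := Nat.find_min hall (m := k) (by omega)
      push Not at hmin
      refine le_add_left (le_trans ?_ (ENNReal.le_tsum k))
      rw [if_pos hmin, mul_one]
      gcongr

/-- The integral of `W ^ (1 + ε)` is that of `W ^ ε` against `ν`. Passing to the next layer costs `A
^ ε` and gains the decay factor `θ`, so the layers form a geometric series for small `ε`. -/
theorem local_reverse_holder (hp : 1 ≤ p) (hκ : 0 < κ) (hW : Measurable W) {a b : ℝ}
    (ha : 0 ≤ a) (hb : 0 < b) (H : ForwardDensity p κ a W 2⁻¹ (ENNReal.ofReal b)) :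
    ∃ ε C : ℝ, 0 < ε ∧ 0 < C ∧ ∀ (E : Set (SpaceTime n)) (σ : ℝ), 0 < σ → MeasurableSet E →
      volume.withDensity W (thick p κ E σ) ≠ ∞ →
      ∫⁻ z in E, W z ^ (1 + ε) ≤ ENNReal.ofReal C *
        ((volume.withDensity W (thick p κ E σ) / cylVol n p κ σ) ^ ε *
          volume.withDensity W (thick p κ E σ)) := by
  obtain ⟨A, K, hA, hK, hdec⟩ := superlevel_decay hp hκ hW ha hb H
  have hA0 : 0 < A := by linarith
  set θ := (A + 1) / (A + 2) with hθ
  have hθ0 : 0 < θ := by positivity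
  have hθ1 : θ < 1 := by rw [hθ, div_lt_one (by linarith)]; linarith
  obtain ⟨ε, hε, hAε⟩ : ∃ ε : ℝ, 0 < ε ∧ A ^ ε * θ < 1 := by
    have hcont : Filter.Tendsto (fun ε : ℝ => A ^ ε * θ) (nhds 0) (nhds (A ^ (0:ℝ) * θ)) :=
      ((Real.continuous_const_rpow hA0.ne').mul continuous_const).tendsto 0
    have hlt : A ^ (0:ℝ) * θ < 1 := by simpa using hθ1
    have hev := (hcont.eventually (gt_mem_nhds hlt)).filter_mono nhdsWithin_le_nhds
      (f₁ := nhdsWithin (0:ℝ) (Ioi 0))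
    obtain ⟨ε, h1, h2⟩ := (hev.and self_mem_nhdsWithin).exists
    exact ⟨ε, h2, h1⟩
  set S := A ^ ε * (1 - A ^ ε * θ)⁻¹ with hS
  have hS0 : 0 < S := mul_pos (by positivity) (inv_pos.2 (by linarith))
  refine ⟨ε, K ^ ε * (1 + S), hε, by positivity, fun E σ hσ hE hν1 => ?_⟩
  set ν := volume.withDensity W with hν
  set ν₀ := ν (thick p κ E σ)
  have hEν : ν E ≤ ν₀ := measure_mono (subset_thick hκ E hσ)
  have hWε : Measurable fun z => W z ^ ε := hW.pow_const ε
  have hint : ∫⁻ z in E, W z ^ (1 + ε) = ∫⁻ z in E, W z ^ ε ∂ν := by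
    rw [hν, setLIntegral_withDensity_eq_setLIntegral_mul volume hW hWε hE]
    refine lintegral_congr fun z => ?_
    rw [Pi.mul_apply, ENNReal.rpow_add_of_nonneg _ _ zero_le_one hε.le, ENNReal.rpow_one]
  rw [hint]
  by_cases hν0 : ν₀ = 0
  · have : ν E = 0 := le_antisymm (hEν.trans hν0.le) (by simp)
    rw [setLIntegral_measure_zero _ _ this]
    simp
  set l := ENNReal.ofReal K * (ν₀ / cylVol n p κ σ) with hl
  have hl0 : l ≠ 0 := mul_ne_zero (by simpa using hK)
    (ENNReal.div_ne_zero.2 ⟨hν0, cylVol_ne_top _⟩)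
  have hmk : ∀ k : ℕ, MeasurableSet {y | ENNReal.ofReal A ^ k * l ≤ W y} := fun k =>
    measurableSet_le measurable_const hW
  have hlayer : ∀ k : ℕ, ∫⁻ z in E, (ENNReal.ofReal A ^ (k + 1) * l) ^ ε *
      (if ENNReal.ofReal A ^ k * l ≤ W z then 1 else 0) ∂ν ≤
      l ^ ε * ν₀ * ENNReal.ofReal (A ^ ε * (A ^ ε * θ) ^ k) := by
    intro k
    have h1 : ∀ z, (if ENNReal.ofReal A ^ k * l ≤ W z then (1 : ℝ≥0∞) else 0) =
        {y | ENNReal.ofReal A ^ k * l ≤ W y}.indicator 1 z := fun z => by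
      simp [indicator]
    simp only [h1]
    rw [lintegral_const_mul _ (measurable_one.indicator (hmk k)), lintegral_indicator_one (hmk k),
      Measure.restrict_apply (hmk k), inter_comm]
    calc (ENNReal.ofReal A ^ (k + 1) * l) ^ ε * ν (E ∩ {y | ENNReal.ofReal A ^ k * l ≤ W y})
        ≤ (ENNReal.ofReal A ^ (k + 1) * l) ^ ε * (ENNReal.ofReal θ ^ k * ν₀) := by
          gcongr
          exact hdec E σ hσ hν0 hν1 k
      _ = l ^ ε * ν₀ * ((ENNReal.ofReal A ^ (k + 1)) ^ ε * ENNReal.ofReal θ ^ k) := by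
          rw [ENNReal.mul_rpow_of_nonneg _ _ hε.le]
          ring
      _ = _ := by
          rw [← ENNReal.ofReal_pow hA0.le, ENNReal.ofReal_rpow_of_nonneg (by positivity) hε.le,
            ← ENNReal.ofReal_pow hθ0.le, ← ENNReal.ofReal_mul (by positivity)]
          congr 2
          rw [← Real.rpow_pow_comm hA0.le, mul_pow, pow_succ]
          ring
  calc ∫⁻ z in E, W z ^ ε ∂ν
      ≤ ∫⁻ z in E, (l ^ ε + ∑' k : ℕ, (ENNReal.ofReal A ^ (k + 1) * l) ^ ε *
          (if ENNReal.ofReal A ^ k * l ≤ W z then 1 else 0)) ∂ν :=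
        lintegral_mono fun z => rpow_le_add_tsum_layers hε (by simpa using hA.le) hl0
    _ = l ^ ε * ν E + ∑' k : ℕ, ∫⁻ z in E, (ENNReal.ofReal A ^ (k + 1) * l) ^ ε *
          (if ENNReal.ofReal A ^ k * l ≤ W z then 1 else 0) ∂ν := by
        rw [lintegral_add_left measurable_const, setLIntegral_const, lintegral_tsum]
        exact fun k => (measurable_const.mul
          (Measurable.ite (hmk k) measurable_const measurable_const)).aemeasurable
    _ ≤ l ^ ε * ν₀ + ∑' k : ℕ, l ^ ε * ν₀ * ENNReal.ofReal (A ^ ε * (A ^ ε * θ) ^ k) := by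
        gcongr
        exact hlayer _
    _ = l ^ ε * ν₀ * ENNReal.ofReal (1 + S) := by
        have hgeo : HasSum (fun k : ℕ => A ^ ε * (A ^ ε * θ) ^ k) S :=
          (hasSum_geometric_of_lt_one (by positivity) hAε).mul_left _
        rw [ENNReal.tsum_mul_left, ← ENNReal.ofReal_tsum_of_nonneg (fun k => by positivity)
          hgeo.summable, hgeo.tsum_eq, ENNReal.ofReal_add zero_le_one hS0.le, ENNReal.ofReal_one]
        ring
    _ = _ := by
        rw [hl, ENNReal.mul_rpow_of_nonneg _ _ hε.le, ENNReal.ofReal_mul (by positivity),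
          ENNReal.ofReal_rpow_of_pos hK]
        ring

end ReverseHolder

/-! ### Comparison of masses forward in time along chains. -/

section Chaining

variable {n : ℕ} {p κ : ℝ} {W : SpaceTime n → ℝ≥0∞}

/-- Forward density is applied at radius `2 * ρ`, which leaves room to move `z'`. The target fills
the fraction `2 ^ (-(n + p))` of the forward cylinder and the exceptional set at most half of that,
so half of the target is good. -/
theorem withDensity_cyl_le_step (hp : 1 ≤ p) (hκ : 0 < κ) (hW : Measurable W) {a b : ℝ}
    (hb : 0 < b)
    (H : ForwardDensity p κ a W (ENNReal.ofReal ((2 * 2 ^ (n + p))⁻¹)) (ENNReal.ofReal b))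
    {z z' : SpaceTime n} {ρ : ℝ} (hρ : 0 < ρ) (h1 : ∀ i, |z'.1 i - z.1 i| ≤ ρ)
    (h2 : |z'.2 - z.2 - a * (2 * ρ) ^ p| ≤ κ * ρ ^ p) :
    volume.withDensity W (cyl p κ z ρ) ≤
      ENNReal.ofReal (2 * 2 ^ (n + p) / b) * volume.withDensity W (cyl p κ z' ρ) := by
  set ν := volume.withDensity W
  have hρ2 : 0 < 2 * ρ := by linarith
  have hV2 : cylVol n p κ (2 * ρ) = ENNReal.ofReal (2 ^ (n + p)) * cylVol n p κ ρ :=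
    cylVol_mul (by norm_num) hρ.le
  set c := ν (cyl p κ z (2 * ρ)) / cylVol n p κ (2 * ρ) with hc
  have hcV : c * cylVol n p κ (2 * ρ) = ν (cyl p κ z (2 * ρ)) :=
    ENNReal.div_mul_cancel (cylVol_ne_zero hκ hρ2) (cylVol_ne_top _)
  have hpow : 2 * ρ ^ p ≤ (2 * ρ) ^ p := by
    have := Real.add_rpow_le_rpow_add hρ.le hρ.le hp
    rwa [← two_mul, ← two_mul] at this
  have hD : cyl p κ z' ρ ⊆ cyl p κ (z + (0, a * (2 * ρ) ^ p)) (2 * ρ) := by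
    intro y hy
    rw [mem_cyl] at hy ⊢
    simp only [Prod.fst_add, Prod.snd_add, add_zero]
    constructor
    · intro i
      have := abs_sub_le (y.1 i) (z'.1 i) (z.1 i)
      linarith [hy.1 i, h1 i]
    · have := abs_sub_le y.2 z'.2 (z.2 + a * (2 * ρ) ^ p)
      rw [← sub_sub z'.2] at this
      nlinarith [hy.2]
  have hX := H.le_volume hW hρ2 hD hcV.le hκ
  rw [volume_cyl _ hρ] at hX
  set X := volume (cyl p κ z' ρ ∩ {y | ENNReal.ofReal b * c ≤ W y})
  set v := cylVol n p κ ρ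
  have hη : ENNReal.ofReal ((2 * 2 ^ (n + p))⁻¹) * cylVol n p κ (2 * ρ) = 2⁻¹ * v := by
    rw [hV2, ← mul_assoc, ← ENNReal.ofReal_mul (by positivity)]
    congr 1
    rw [mul_inv, mul_assoc, inv_mul_cancel₀ (by positivity), mul_one,
      ENNReal.ofReal_inv_of_pos (by norm_num)]
    norm_num
  have hv : v ≤ 2 * X := by
    have h3 : 2⁻¹ * v + 2⁻¹ * v = v := by rw [← add_mul, ENNReal.inv_two_add_inv_two, one_mul]
    have h4 : 2⁻¹ * v ≤ X := by
      rw [hη] at hX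
      refine (ENNReal.add_le_add_iff_right (a := 2⁻¹ * v) ?_).1 (h3.trans_le hX)
      exact ENNReal.mul_ne_top (by simp) (cylVol_ne_top _)
    rw [two_mul, ← h3]
    gcongr
  have hbX : ENNReal.ofReal b * c * X ≤ ν (cyl p κ z' ρ) :=
    (mul_volume_le_withDensity hW fun y hy => hy.2).trans (measure_mono inter_subset_left)
  calc ν (cyl p κ z ρ) ≤ ν (cyl p κ z (2 * ρ)) :=
        measure_mono (cyl_mono hp hκ z hρ.le (by linarith))
    _ = c * (ENNReal.ofReal (2 ^ (n + p)) * v) := by rw [← hcV, hV2]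
    _ ≤ c * (ENNReal.ofReal (2 ^ (n + p)) * (2 * X)) := by gcongr
    _ = ENNReal.ofReal (2 * 2 ^ (n + p) / b) * (ENNReal.ofReal b * c * X) := by
        have : ENNReal.ofReal (2 * 2 ^ (n + p) / b) * ENNReal.ofReal b =
            2 * ENNReal.ofReal (2 ^ (n + p)) := by
          rw [← ENNReal.ofReal_mul (by positivity), div_mul_cancel₀ _ hb.ne',
            ENNReal.ofReal_mul (by norm_num), ENNReal.ofReal_ofNat]
        rw [mul_assoc (ENNReal.ofReal b), ← mul_assoc (ENNReal.ofReal (_ / b)), this]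
        ring
    _ ≤ _ := by gcongr

theorem withDensity_cyl_le_chain {a : ℝ} {C : ℝ≥0∞} {ρ : ℝ}
    (hstep : ∀ z z' : SpaceTime n, (∀ i, |z'.1 i - z.1 i| ≤ ρ) →
      |z'.2 - z.2 - a * (2 * ρ) ^ p| ≤ κ * ρ ^ p →
      volume.withDensity W (cyl p κ z ρ) ≤ C * volume.withDensity W (cyl p κ z' ρ))
    (N : ℕ) (z z' : SpaceTime n) (h1 : ∀ i, |z'.1 i - z.1 i| ≤ N * ρ)
    (h2 : |z'.2 - z.2 - N * (a * (2 * ρ) ^ p)| ≤ N * (κ * ρ ^ p)) :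
    volume.withDensity W (cyl p κ z ρ) ≤ C ^ N * volume.withDensity W (cyl p κ z' ρ) := by
  induction N generalizing z' with
  | zero =>
    have : z' = z := by
      refine Prod.ext (funext fun i => ?_) ?_
      · have := h1 i
        simp only [Nat.cast_zero, zero_mul, abs_nonpos_iff] at this
        linarith
      · simp only [Nat.cast_zero, zero_mul, abs_nonpos_iff] at h2
        linarith
    rw [this, pow_zero, one_mul]
  | succ N ih =>
    push_cast at h1 h2
    have hN : (0:ℝ) < N + 1 := by positivity
    set P := a * (2 * ρ) ^ p
    set Q := κ * ρ ^ p
    -- The last intermediate centre lies on the segment from `z` to `z'`, so all steps are equal and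
    -- each carries an equal share of the deviation.
    set w : SpaceTime n := (fun i => z.1 i + N / (N + 1) * (z'.1 i - z.1 i),
      z.2 + N / (N + 1) * (z'.2 - z.2)) with hw
    have e1 : ∀ d M : ℝ, |d| ≤ (N + 1) * M → |(N / (N + 1) : ℝ) * d| ≤ N * M := fun d M h => by
      rw [abs_mul, abs_of_nonneg (by positivity)]
      calc (N / (N + 1) : ℝ) * |d| ≤ N / (N + 1) * ((N + 1) * M) := by gcongr
        _ = N * M := by field_simp
    have e2 : ∀ d M : ℝ, |d| ≤ (N + 1) * M → |(1 / (N + 1) : ℝ) * d| ≤ M := fun d M h => by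
      rw [abs_mul, abs_of_nonneg (by positivity)]
      calc (1 / (N + 1) : ℝ) * |d| ≤ 1 / (N + 1) * ((N + 1) * M) := by gcongr
        _ = M := by field_simp
    have hzw := ih w (fun i => by
        convert e1 _ _ (h1 i) using 2
        simp [hw]) (by
        convert e1 _ _ h2 using 2
        simp only [hw]
        field_simp
        ring)
    have hwz := hstep w z' (fun i => by
        convert e2 _ _ (h1 i) using 2
        simp only [hw]
        field_simp
        ring) (by
        convert e2 _ _ h2 using 2
        simp only [hw]
        field_simp
        ring)
    calc _ ≤ _ := hzw
      _ ≤ C ^ N * (C * volume.withDensity W (cyl p κ z' ρ)) := by gcongr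
      _ = _ := by rw [pow_succ, mul_assoc]

/-- Clamping to `[-(M - d), M - d]`. It moves a centre within `d` of a region to one whose whole
`d`-neighbourhood lies inside, coordinate by coordinate. -/
theorem exists_contraction {u M d : ℝ} (hd : 0 ≤ d) (hdM : d ≤ M) (hu : |u| ≤ M + d) :
    ∃ v, |v| ≤ M - d ∧ |v - u| ≤ 2 * d := by
  rw [abs_le] at hu
  rcases le_total u (-(M - d)) with h | h
  · exact ⟨-(M - d), abs_le.2 ⟨by linarith, by linarith⟩, abs_le.2 ⟨by linarith, by linarith⟩⟩
  · rcases le_total u (M - d) with h' | h'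
    · exact ⟨u, abs_le.2 ⟨by linarith, by linarith⟩, by simpa using hd⟩
    · exact ⟨M - d, abs_le.2 ⟨by linarith, by linarith⟩, abs_le.2 ⟨by linarith, by linarith⟩⟩

/-- The factor `1 + h / κ` absorbs the change of shape from `h` to `κ`. -/
theorem cyl_subset_cyl_of_mem_thick (hp : 1 ≤ p) (hκ : 0 < κ) {h : ℝ} (hh : 0 < h)
    {c : SpaceTime n} {L r s : ℝ} (hL : 0 < L) (hr : 0 ≤ r) (hs : 0 ≤ s) {y : SpaceTime n}
    (hy : y ∈ thick p κ (cyl p h c L) r) : cyl p κ y s ⊆ cyl p κ c ((1 + h / κ) * L + r + s) := by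
  obtain ⟨e, he, hye⟩ := hy
  have h1 : 1 ≤ 1 + h / κ := by linarith [div_pos hh hκ]
  have hec : e ∈ cyl p κ c ((1 + h / κ) * L) := by
    rw [mem_cyl] at he ⊢
    refine ⟨fun i => (he.1 i).trans (le_mul_of_one_le_left hL.le h1), he.2.trans_le ?_⟩
    rw [Real.mul_rpow (by positivity) hL.le, ← mul_assoc]
    gcongr
    have h2 : 1 + h / κ ≤ (1 + h / κ) ^ p := by
      simpa using Real.rpow_le_rpow_of_exponent_le h1 hp
    calc h ≤ κ * (1 + h / κ) := by rw [mul_add, mul_div_cancel₀ _ hκ.ne']; linarith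
      _ ≤ _ := by gcongr
  exact cyl_subset_cyl_add hp hκ (by positivity) hs
    (mem_cyl_add hp hκ (by positivity) hr hec hye)

/-- Chains lead from every small cylinder centred in the neighbourhood into the translate, and
boundedly many such cylinders cover the neighbourhood. -/
theorem forward_comparison (hp : 1 ≤ p) (hκ : 0 < κ) (hW : Measurable W) {a b : ℝ}
    (ha : 0 < a) (hb : 0 < b)
    (H : ForwardDensity p κ a W (ENNReal.ofReal ((2 * 2 ^ (n + p))⁻¹)) (ENNReal.ofReal b))
    {h T : ℝ} (hh : 0 < h) (hT : 0 < T) :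
    ∃ η C : ℝ, 0 < η ∧ 0 < C ∧ ∀ (c : SpaceTime n) (L : ℝ), 0 < L →
      volume.withDensity W (thick p κ (cyl p h c L) (η * L)) ≤
        ENNReal.ofReal C * volume.withDensity W (cyl p h (c + (0, T * L ^ p)) L) := by
  have hp0 : 0 < p := by linarith
  obtain ⟨P, hP⟩ : ∃ P, P = a * 2 ^ p := ⟨_, rfl⟩
  have hP0 : 0 < P := by rw [hP]; positivity
  -- The three bounds give, in order: `N` steps absorb the displacement of two radii produced by
  -- clamping; `η ≤ 1`; `κ * η ^ p ≤ h`.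
  obtain ⟨N, hN⟩ := exists_nat_ge (max 2 (max (T / P) (κ * T / (h * P))))
  have hN2 : (2:ℝ) ≤ N := (le_max_left _ _).trans hN
  have hN3 : T / P ≤ N := (le_max_left _ _).trans ((le_max_right _ _).trans hN)
  have hN4 : κ * T / (h * P) ≤ N := (le_max_right _ _).trans ((le_max_right _ _).trans hN)
  rw [div_le_iff₀ (by positivity)] at hN3 hN4
  have hN0 : (0:ℝ) < N := by linarith
  -- The radius for which `N` forward steps last exactly `T * L ^ p`; see `htime`.
  set η := (T / (N * P)) ^ p⁻¹ with hη
  have hη0 : 0 < η := by positivity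
  have hηp : η ^ p = T / (N * P) := Real.rpow_inv_rpow (by positivity) hp0.ne'
  have hη1 : η ≤ 1 := Real.rpow_le_one (by positivity)
    ((div_le_one (by positivity)).2 hN3) (by positivity)
  have hηκ : κ * η ^ p ≤ h := by
    rw [hηp, ← mul_div_assoc, div_le_iff₀ (by positivity)]
    linarith
  have hηT : N * (P * η ^ p) = T := by
    rw [hηp]
    field_simp
  set C₁ := 2 * 2 ^ (n + p) / b with hC₁
  have hC₁0 : 0 < C₁ := by positivity
  set R := ((1 + h / κ) + η + η / 3) * (3 / η) with hR
  have hR0 : 0 < R := by positivity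
  refine ⟨η, C₁ ^ N * R ^ (n + p), hη0, by positivity, fun c L hL => ?_⟩
  set ν := volume.withDensity W
  set S := cyl p h (c + (0, T * L ^ p)) L
  have hLp : 0 < L ^ p := by positivity
  have hρp : (η * L) ^ p = η ^ p * L ^ p := Real.mul_rpow hη0.le hL.le
  have h2ρp : (2 * (η * L)) ^ p = 2 ^ p * (η ^ p * L ^ p) := by
    rw [Real.mul_rpow (by norm_num) (by positivity), hρp]
  have htime : N * (a * (2 * (η * L)) ^ p) = T * L ^ p := by
    rw [h2ρp, ← hηT, hP]
    ring
  have hpoint : ∀ z ∈ thick p κ (cyl p h c L) (η * L),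
      ν (cyl p κ z (η * L)) ≤ ENNReal.ofReal C₁ ^ N * ν S := by
    rintro z ⟨e, he, hze⟩
    rw [mem_cyl] at he hze
    rw [hρp] at hze
    have hx : ∀ i, ∃ v, |v| ≤ L - η * L ∧ |v - (z.1 i - c.1 i)| ≤ 2 * (η * L) := fun i =>
      exists_contraction (by positivity) (by nlinarith) (by
        have := abs_sub_le (z.1 i) (e.1 i) (c.1 i)
        linarith [he.1 i, hze.1 i])
    choose v hv1 hv2 using hx
    obtain ⟨τ, hτ1, hτ2⟩ := exists_contraction (u := z.2 - c.2) (M := h * L ^ p)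
      (d := κ * (η ^ p * L ^ p)) (by positivity) (by
        rw [← mul_assoc]
        gcongr) (by
        have := abs_sub_le z.2 e.2 c.2
        linarith [he.2, hze.2])
    set z' : SpaceTime n := (fun i => c.1 i + v i, c.2 + T * L ^ p + τ) with hz'
    have hchain := withDensity_cyl_le_chain (W := W) (p := p) (κ := κ) (a := a)
      (C := ENNReal.ofReal C₁) (ρ := η * L)
      (fun z z' h1 h2 => withDensity_cyl_le_step hp hκ hW hb H (by positivity) h1 h2) N z z'
      (fun i => by
        rw [show z'.1 i - z.1 i = v i - (z.1 i - c.1 i) by simp only [hz']; ring]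
        exact (hv2 i).trans (by gcongr)) (by
        rw [htime, hρp,
          show z'.2 - z.2 - T * L ^ p = τ - (z.2 - c.2) by simp only [hz']; ring]
        exact hτ2.trans (by gcongr))
    refine hchain.trans (mul_le_mul_right (measure_mono fun y hy => ?_) _)
    rw [mem_cyl] at hy ⊢
    rw [hρp] at hy
    simp only [Prod.fst_add, Prod.snd_add, add_zero]
    constructor
    · intro i
      have h1 := abs_sub_le (y.1 i) (z'.1 i) (c.1 i)
      have h2 : z'.1 i - c.1 i = v i := by simp only [hz']; ring
      rw [h2] at h1
      linarith [hy.1 i, hv1 i]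
    · have h1 := abs_sub_le y.2 z'.2 (c.2 + T * L ^ p)
      have h2 : z'.2 - (c.2 + T * L ^ p) = τ := by simp only [hz']; ring
      rw [h2] at h1
      linarith [hy.2]
  obtain ⟨u, huT, huc, hdisj, hcov⟩ := exists_disjoint_cyl_covering hp hκ one_pos
    {i : SpaceTime n × ℝ | i.1 ∈ thick p κ (cyl p h c L) (η * L) ∧ i.2 = η / 3 * L} (η / 3 * L)
    (fun i hi => by rw [hi.2]; exact ⟨by positivity, le_rfl⟩)
  have hsub : thick p κ (cyl p h c L) (η * L) ⊆ ⋃ j ∈ u, cyl p κ j.1 (η * L) := by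
    intro z hz
    obtain ⟨j, hj, hzj⟩ := hcov (z, η / 3 * L) ⟨hz, rfl⟩
    rw [(huT hj).2, show 3 * 1 * (η / 3 * L) = η * L by ring] at hzj
    exact mem_biUnion hj hzj
  set v := cylVol n p κ (η / 3 * L)
  have hv0 : v ≠ 0 := cylVol_ne_zero hκ (by positivity)
  have hv1 : v ≠ ∞ := cylVol_ne_top _
  -- The disjoint cores have equal volume and fit in one cylinder of `R` times their radius, which
  -- bounds their number.
  have hcount : ∑' _ : u, v ≤ ENNReal.ofReal (R ^ (n + p)) * v := by
    have hbig : volume (cyl p κ c (R * (η / 3 * L))) = ENNReal.ofReal (R ^ (n + p)) * v := by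
      rw [volume_cyl _ (by positivity), cylVol_mul hR0.le (by positivity)]
    rw [← hbig]
    calc ∑' _ : u, v = ∑' j : u, volume (cyl p κ j.1.1 (1 * j.1.2)) := by
          refine tsum_congr fun j => ?_
          rw [one_mul, (huT j.2).2, volume_cyl _ (by positivity)]
      _ = volume (⋃ j ∈ u, cyl p κ j.1 (1 * j.2)) := by
          rw [measure_biUnion huc hdisj]
          intro j hj
          refine measurableSet_cyl _ ?_
          rw [(huT hj).2]
          positivity
      _ ≤ _ := by
          refine measure_mono (iUnion₂_subset fun j hj => ?_)
          rw [one_mul, (huT hj).2]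
          have hRL : R * (η / 3 * L) = (1 + h / κ) * L + η * L + η / 3 * L := by
            rw [hR]
            field_simp
          rw [hRL]
          exact cyl_subset_cyl_of_mem_thick hp hκ hh hL (by positivity) (by positivity) (huT hj).1
  calc ν (thick p κ (cyl p h c L) (η * L)) ≤ ∑' j : u, ν (cyl p κ j.1.1 (η * L)) :=
        (measure_mono hsub).trans (measure_biUnion_le _ huc _)
    _ ≤ ∑' _ : u, ENNReal.ofReal C₁ ^ N * ν S * v⁻¹ * v := by
        refine ENNReal.tsum_le_tsum fun j => ?_
        rw [mul_assoc _ v⁻¹, ENNReal.inv_mul_cancel hv0 hv1, mul_one]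
        exact hpoint _ (huT j.2).1
    _ = ENNReal.ofReal C₁ ^ N * ν S * v⁻¹ * ∑' _ : u, v := ENNReal.tsum_mul_left
    _ ≤ ENNReal.ofReal C₁ ^ N * ν S * v⁻¹ * (ENNReal.ofReal (R ^ (n + p)) * v) := by gcongr
    _ = ENNReal.ofReal C₁ ^ N * ENNReal.ofReal (R ^ (n + p)) * ν S * (v⁻¹ * v) := by ring
    _ = _ := by
        rw [ENNReal.inv_mul_cancel hv0 hv1, mul_one, ← ENNReal.ofReal_pow hC₁0.le,
          ← ENNReal.ofReal_mul (by positivity)]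

end Chaining

/-! ### From the Muckenhoupt condition to forward density. -/

section Weights

variable {n : ℕ} {p : ℝ}

theorem lowerPart_eq_cyl (γ : ℝ) (x : Fin n → ℝ) (t L : ℝ) :
    lowerPart p γ x t L = cyl p ((1 - γ) / 2) (x, t - (1 + γ) / 2 * L ^ p) L := by
  rw [lowerPart, cyl]
  congr 2 <;> simp only <;> ring

theorem upperPart_eq_cyl (γ : ℝ) (x : Fin n → ℝ) (t L : ℝ) :
    upperPart p γ x t L = cyl p ((1 - γ) / 2) (x, t + (1 + γ) / 2 * L ^ p) L := by
  rw [upperPart, cyl]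
  congr 2 <;> simp only <;> ring

theorem timeTranslate_cyl (κ : ℝ) (c : SpaceTime n) (L s : ℝ) :
    timeTranslate (cyl p κ c L) s = cyl p κ (c + (0, s)) L := by
  ext y
  simp only [timeTranslate, mem_image]
  constructor
  · rintro ⟨z, hz, rfl⟩
    rw [mem_cyl] at hz ⊢
    simpa using hz
  · intro hy
    refine ⟨y - (0, s), ?_, by simp⟩
    rw [mem_cyl] at hy ⊢
    simp only [Prod.fst_add, Prod.snd_add, add_zero, Prod.fst_sub, Prod.snd_sub, sub_zero] at hy ⊢
    rwa [sub_sub, add_comm s]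

theorem IsWeight.lintegral_cyl_ne_top {w : SpaceTime n → ℝ} (hw : IsWeight w) {κ : ℝ}
    (z : SpaceTime n) {r : ℝ} (hr : 0 ≤ r) :
    ∫⁻ y in cyl p κ z r, ENNReal.ofReal (w y) ≠ ∞ := by
  have hcomp : IsCompact (Metric.closedBall z.1 r ×ˢ Icc (z.2 - κ * r ^ p) (z.2 + κ * r ^ p)) :=
    (isCompact_closedBall _ _).prod isCompact_Icc
  have hint := (hw.1.integrableOn_isCompact hcomp).mono_set (s := cyl p κ z r) (by
    rw [cyl, spaceCube_eq_closedBall _ hr]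
    exact prod_mono_right Ioo_subset_Icc_self)
  refine ((lintegral_mono fun y => ?_).trans_lt hint.hasFiniteIntegral).ne
  rw [← ofReal_norm]
  exact ENNReal.ofReal_le_ofReal (le_abs_self _)

theorem setLAverage_cyl {κ : ℝ} (f : SpaceTime n → ℝ≥0∞) (z : SpaceTime n) {r : ℝ} (hr : 0 < r) :
    ⨍⁻ y in cyl p κ z r, f y ∂volume = (∫⁻ y in cyl p κ z r, f y) / cylVol n p κ r := by
  rw [setLAverage_eq, volume_cyl z hr]

/-- For `q > 1`, on the exceptional set `F` the function `W ^ (1 / (1 - q))` is at least `(b * m) ^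
(1 / (1 - q))`; inserted into the condition, this cancels `m` and leaves `(volume F / v) ^ (q - 1) ≤
b * M`. For `q = 1` the exceptional set is null with `b = C⁻¹`. -/
theorem MemParabolicAq.exists_forwardDensity {q γ : ℝ} (hγ1 : γ < 1) {w : SpaceTime n → ℝ}
    (hw : MemParabolicAq p q γ w) {W : SpaceTime n → ℝ≥0∞} (hW : Measurable W)
    (hwW : (fun z => ENNReal.ofReal (w z)) =ᵐ[volume] W) {η : ℝ} (hη : 0 < η) :
    ∃ b : ℝ, 0 < b ∧
      ForwardDensity p ((1 - γ) / 2) (1 + γ) W (ENNReal.ofReal η) (ENNReal.ofReal b) := by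
  obtain ⟨κ, hκ⟩ : ∃ κ, κ = (1 - γ) / 2 := ⟨_, rfl⟩
  have hκ0 : 0 < κ := by rw [hκ]; linarith
  rw [← hκ]
  have hlow : ∀ (z : SpaceTime n) (r : ℝ),
      lowerPart p γ z.1 (z.2 + (1 + γ) / 2 * r ^ p) r = cyl p κ z r := fun z r => by
    rw [lowerPart_eq_cyl, add_sub_cancel_right, hκ]
  have hupp : ∀ (z : SpaceTime n) (r : ℝ), upperPart p γ z.1 (z.2 + (1 + γ) / 2 * r ^ p) r =
      cyl p κ (z + (0, (1 + γ) * r ^ p)) r := fun z r => by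
    rw [upperPart_eq_cyl, hκ]
    congr 1
    refine Prod.ext ?_ ?_ <;> simp only [Prod.fst_add, Prod.snd_add, add_zero]
    ring
  have hav : ∀ (z : SpaceTime n) (r : ℝ), 0 < r →
      ⨍⁻ y in cyl p κ z r, ENNReal.ofReal (w y) ∂volume =
        volume.withDensity W (cyl p κ z r) / cylVol n p κ r := fun z r hr => by
    rw [setLAverage_cyl _ _ hr, withDensity_apply W (measurableSet_cyl z hr.le)]
    congr 1
    exact lintegral_congr_ae (ae_restrict_of_ae hwW)
  rcases hw.2 with ⟨hq, hM⟩ | ⟨-, C, hC, h1⟩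
  · set M := muckenhouptConst p q γ w with hMdef
    have hq1 : 0 < q - 1 := by linarith
    have hM0 : 0 < M.toReal + 1 := by positivity
    -- The added 1 keeps `b` finite when `M = 0`.
    refine ⟨η ^ (q - 1) / (M.toReal + 1), by positivity, fun z r hr => ?_⟩
    set b := η ^ (q - 1) / (M.toReal + 1) with hb
    have hb0 : 0 < b := by positivity
    have hbM : ENNReal.ofReal b * M ≤ ENNReal.ofReal η ^ (q - 1) := by
      rw [← ENNReal.ofReal_toReal hM.ne, ← ENNReal.ofReal_mul hb0.le,
        ENNReal.ofReal_rpow_of_pos hη]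
      apply ENNReal.ofReal_le_ofReal
      rw [hb, div_mul_eq_mul_div, div_le_iff₀ hM0]
      have : 0 < η ^ (q - 1) := by positivity
      nlinarith
    have hMz : (⨍⁻ y in cyl p κ z r, ENNReal.ofReal (w y) ∂volume) *
        (⨍⁻ y in cyl p κ (z + (0, (1 + γ) * r ^ p)) r,
          ENNReal.ofReal (w y) ^ (1 / (1 - q)) ∂volume) ^ (q - 1) ≤ M := by
      rw [← hlow z r, ← hupp z r, hMdef, muckenhouptConst]
      exact le_iSup_of_le z.1 (le_iSup_of_le (z.2 + (1 + γ) / 2 * r ^ p)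
        (le_iSup_of_le r (le_iSup_of_le hr le_rfl)))
    rw [hav z r hr, setLAverage_cyl _ _ hr] at hMz
    set v := cylVol n p κ r
    have hv0 : v ≠ 0 := cylVol_ne_zero hκ0 hr
    have hv1 : v ≠ ∞ := cylVol_ne_top r
    set m := volume.withDensity W (cyl p κ z r) / v with hmdef
    have hmtop : m ≠ ∞ := by
      refine ENNReal.div_ne_top ?_ hv0
      rw [withDensity_apply W (measurableSet_cyl z hr.le),
        ← lintegral_congr_ae (ae_restrict_of_ae hwW)]
      exact hw.1.lintegral_cyl_ne_top z hr.le
    set U := cyl p κ (z + (0, (1 + γ) * r ^ p)) r with hU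
    set F := U ∩ {y | W y < ENNReal.ofReal b * m} with hF
    by_cases hm0 : m = 0
    · simp [hF, hm0]
    have hbne : ENNReal.ofReal b ≠ 0 := by simpa using hb0
    set g := ENNReal.ofReal b * m with hg
    have hg0 : g ≠ 0 := mul_ne_zero hbne hm0
    have hgtop : g ≠ ∞ := ENNReal.mul_ne_top ENNReal.ofReal_ne_top hmtop
    have hs : 1 / (1 - q) < 0 := one_div_neg.2 (by linarith)
    have hI : g ^ (1 / (1 - q)) * volume F ≤
        ∫⁻ y in U, ENNReal.ofReal (w y) ^ (1 / (1 - q)) := by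
      calc g ^ (1 / (1 - q)) * volume F = ∫⁻ _ in F, g ^ (1 / (1 - q)) :=
            (setLIntegral_const _ _).symm
        _ ≤ ∫⁻ y in F, W y ^ (1 / (1 - q)) := by
            refine setLIntegral_mono (hW.pow_const _) fun y hy => ?_
            have hy2 : W y ≤ g := le_of_lt hy.2
            rw [← neg_neg (1 / (1 - q)), ENNReal.rpow_neg, ENNReal.rpow_neg (W y)]
            exact ENNReal.inv_le_inv.2 (ENNReal.rpow_le_rpow hy2 (by linarith))
        _ ≤ ∫⁻ y in U, W y ^ (1 / (1 - q)) := lintegral_mono_set inter_subset_left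
        _ = _ := by
            refine lintegral_congr_ae (ae_restrict_of_ae (hwW.mono fun y hy => ?_))
            simp only at hy
            simp only [hy]
    have hmain : (volume F / v) ^ (q - 1) ≤ ENNReal.ofReal η ^ (q - 1) := by
      refine le_trans ?_ hbM
      have h1 : m * ((g ^ (1 / (1 - q)) * volume F) / v) ^ (q - 1) ≤ M :=
        le_trans (by gcongr) hMz
      rw [mul_div_assoc, ENNReal.mul_rpow_of_nonneg _ _ hq1.le, ← ENNReal.rpow_mul,
        show 1 / (1 - q) * (q - 1) = -1 by
          rw [div_mul_eq_mul_div, one_mul, div_eq_iff (by linarith)]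
          ring, ENNReal.rpow_neg_one, ← mul_assoc] at h1
      have h2 : ENNReal.ofReal b * (m * g⁻¹) = 1 := by
        rw [← mul_assoc, ← hg, ENNReal.mul_inv_cancel hg0 hgtop]
      calc (volume F / v) ^ (q - 1)
          = ENNReal.ofReal b * (m * g⁻¹ * (volume F / v) ^ (q - 1)) := by
            rw [← mul_assoc, h2, one_mul]
        _ ≤ _ := by gcongr
    have := (ENNReal.rpow_le_rpow_iff hq1).1 hmain
    rwa [ENNReal.div_le_iff hv0 hv1] at this
  · refine ⟨C⁻¹, by positivity, fun z r hr => ?_⟩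
    have h2 := h1 z.1 (z.2 + (1 + γ) / 2 * r ^ p) r hr
    rw [hlow, hupp, hav z r hr] at h2
    set m := volume.withDensity W (cyl p κ z r) / cylVol n p κ r
    set U := cyl p κ (z + (0, (1 + γ) * r ^ p)) r with hU
    have hae : ∀ᵐ y ∂volume.restrict U, ENNReal.ofReal C⁻¹ * m ≤ W y := by
      filter_upwards [ae_essInf_le (f := fun z => ENNReal.ofReal (w z))
        (μ := volume.restrict U), ae_restrict_of_ae (s := U) hwW] with y hy hy2
      rw [← hy2]
      refine le_trans ?_ hy
      calc _ ≤ ENNReal.ofReal C⁻¹ * (ENNReal.ofReal C *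
            essInf (fun z => ENNReal.ofReal (w z)) (volume.restrict U)) := by gcongr
        _ = _ := by
            rw [← mul_assoc, ← ENNReal.ofReal_mul (by positivity), inv_mul_cancel₀ hC.ne',
              ENNReal.ofReal_one, one_mul]
    have h0 : volume (U ∩ {y | W y < ENNReal.ofReal C⁻¹ * m}) = 0 := by
      have h3 : (volume.restrict U) {y | W y < ENNReal.ofReal C⁻¹ * m} = 0 := by
        simpa [ae_iff] using hae
      rwa [Measure.restrict_apply (measurableSet_lt hW measurable_const), inter_comm] at h3
    rw [h0]
    simp

end Weights

/-! ### Assembly of the corollary. -/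

theorem mainTheorem10 (n : ℕ) (hn : 1 ≤ n) (p q γ : ℝ) (hp : 1 < p) (hq : 1 ≤ q)
    (hγ0 : 0 < γ) (hγ1 : γ < 1) (w : SpaceTime n → ℝ) (hw : MemParabolicAq p q γ w)
    (α τ : ℝ) (hα0 : 0 ≤ α) (hα1 : α < 1) (hτ : 0 < τ) :
    ∃ ε c : ℝ, 0 < ε ∧ 0 < c ∧
      ∀ (x : Fin n → ℝ) (t L : ℝ), 0 < L →
        (⨍⁻ z in lowerPart p α x t L, ENNReal.ofReal (w z) ^ (1 + ε) ∂volume) ^ (1 / (1 + ε)) ≤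
          ENNReal.ofReal c *
            ⨍⁻ z in timeTranslate (lowerPart p α x t L) (τ * (1 - α) * L ^ p),
              ENNReal.ofReal (w z) ∂volume := by
  have hmeas : AEMeasurable (fun z => ENNReal.ofReal (w z)) volume :=
    hw.1.1.aestronglyMeasurable.aemeasurable.ennreal_ofReal
  set W := hmeas.mk
  have hW : Measurable W := hmeas.measurable_mk
  have hwW : (fun z => ENNReal.ofReal (w z)) =ᵐ[volume] W := hmeas.ae_eq_mk
  obtain ⟨κ, hκ⟩ : ∃ κ, κ = (1 - γ) / 2 := ⟨_, rfl⟩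
  have hκ0 : 0 < κ := by rw [hκ]; linarith
  obtain ⟨h, hh⟩ : ∃ h, h = (1 - α) / 2 := ⟨_, rfl⟩
  have hh0 : 0 < h := by rw [hh]; linarith
  have hT : 0 < τ * (1 - α) := mul_pos hτ (by linarith)
  -- Two densities are needed: one half for the stopping argument, and a smaller one for the chain,
  -- where the radius is doubled.
  obtain ⟨b₁, hb₁, H₁⟩ := hw.exists_forwardDensity hγ1 hW hwW (η := 2⁻¹) (by norm_num)
  obtain ⟨b₂, hb₂, H₂⟩ := hw.exists_forwardDensity hγ1 hW hwW (η := (2 * 2 ^ (n + p))⁻¹)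
    (by positivity)
  rw [← hκ] at H₁ H₂
  rw [ENNReal.ofReal_inv_of_pos (by norm_num), ENNReal.ofReal_ofNat] at H₁
  obtain ⟨ε, C₁, hε, hC₁, hrh⟩ := local_reverse_holder hp.le hκ0 hW (by linarith) hb₁ H₁
  obtain ⟨η, C₂, hη, hC₂, hfc⟩ := forward_comparison hp.le hκ0 hW (by linarith) hb₂ H₂ hh0 hT
  set C₃ := κ / h * η ^ (n + p) with hC₃
  have hC₃0 : 0 < C₃ := by positivity
  have hε1 : 0 < 1 + ε := by linarith
  refine ⟨ε, (C₁ * (C₃⁻¹) ^ ε) ^ (1 / (1 + ε)) * C₂, hε, by positivity, fun x t L hL => ?_⟩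
  rw [lowerPart_eq_cyl, timeTranslate_cyl, ← hh]
  set c : SpaceTime n := (x, t - (1 + α) / 2 * L ^ p)
  set ν := volume.withDensity W
  set S := cyl p h (c + (0, τ * (1 - α) * L ^ p)) L with hS
  set v := cylVol n p h L with hv
  have hv0 : v ≠ 0 := cylVol_ne_zero hh0 hL
  have hv1 : v ≠ ∞ := cylVol_ne_top L
  have hfc' := hfc c L hL
  set ν₀ := ν (thick p κ (cyl p h c L) (η * L)) with hν₀
  have hνS : ∫⁻ y in S, ENNReal.ofReal (w y) = ν S := by
    rw [withDensity_apply W (measurableSet_cyl _ hL.le)]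
    exact lintegral_congr_ae (ae_restrict_of_ae hwW)
  have hνfin : ν₀ ≠ ∞ := by
    refine (hfc'.trans_lt (ENNReal.mul_lt_top ENNReal.ofReal_lt_top ?_)).ne
    rw [← hνS]
    exact (hw.1.lintegral_cyl_ne_top _ hL.le).lt_top
  have hvol : cylVol n p κ (η * L) = ENNReal.ofReal C₃ * v := by
    rw [hv, cylVol, cylVol, ← ENNReal.ofReal_mul hC₃0.le, Real.mul_rpow hη.le hL.le, hC₃]
    congr 1
    field_simp
  have hE := hrh (cyl p h c L) (η * L) (by positivity) (measurableSet_cyl _ hL.le) hνfin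
  rw [hvol] at hE
  have hWw : ∫⁻ y in cyl p h c L, ENNReal.ofReal (w y) ^ (1 + ε) =
      ∫⁻ y in cyl p h c L, W y ^ (1 + ε) :=
    lintegral_congr_ae (ae_restrict_of_ae (hwW.mono fun y hy => congrArg (· ^ (1 + ε)) hy))
  rw [setLAverage_cyl _ _ hL, setLAverage_cyl _ _ hL, hνS, hWw]
  have hquot : ν₀ / (ENNReal.ofReal C₃ * v) = ENNReal.ofReal C₃⁻¹ * (ν₀ / v) := by
    rw [ENNReal.div_eq_inv_mul, ENNReal.mul_inv (.inr hv1) (.inl ENNReal.ofReal_ne_top),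
      ENNReal.ofReal_inv_of_pos hC₃0, ENNReal.div_eq_inv_mul, mul_assoc]
  have hkey : (∫⁻ y in cyl p h c L, W y ^ (1 + ε)) / v ≤
      ENNReal.ofReal (C₁ * (C₃⁻¹) ^ ε) * (ν₀ / v) ^ (1 + ε) := by
    calc (∫⁻ y in cyl p h c L, W y ^ (1 + ε)) / v
        ≤ ENNReal.ofReal C₁ * ((ENNReal.ofReal C₃⁻¹ * (ν₀ / v)) ^ ε * ν₀) / v := by
          rw [← hquot]
          gcongr
      _ = _ := by
          rw [ENNReal.mul_rpow_of_nonneg _ _ hε.le, ENNReal.ofReal_mul hC₁.le,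
            ← ENNReal.ofReal_rpow_of_pos (by positivity),
            ENNReal.rpow_add_of_nonneg _ _ zero_le_one hε.le, ENNReal.rpow_one,
            div_eq_mul_inv, div_eq_mul_inv]
          ring
  calc ((∫⁻ y in cyl p h c L, W y ^ (1 + ε)) / v) ^ (1 / (1 + ε))
      ≤ (ENNReal.ofReal (C₁ * (C₃⁻¹) ^ ε) * (ν₀ / v) ^ (1 + ε)) ^ (1 / (1 + ε)) := by gcongr
    _ = ENNReal.ofReal ((C₁ * (C₃⁻¹) ^ ε) ^ (1 / (1 + ε))) * (ν₀ / v) := by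
        rw [ENNReal.mul_rpow_of_nonneg _ _ (by positivity), ← ENNReal.rpow_mul,
          mul_one_div_cancel hε1.ne', ENNReal.rpow_one,
          ENNReal.ofReal_rpow_of_pos (by positivity)]
    _ ≤ ENNReal.ofReal ((C₁ * (C₃⁻¹) ^ ε) ^ (1 / (1 + ε))) * (ENNReal.ofReal C₂ * ν S / v) := by
        gcongr
    _ = _ := by
        rw [ENNReal.ofReal_mul (by positivity), mul_div_assoc, mul_assoc]
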